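/- A feedback arc set of a digraph $D$ is a set of edges of $D$ whose removal leaves an acyclic digraph (equivalently, a set of edges meeting every directed cycle); it is minimal if no proper subset of it is a feedback arc set. For a digraph $D$ and an integer $k\ge 1$, let $f_k(D)$ be the largest $m$ such that every minimal feedback arc set of $D$ contains $m$ pairwise vertex-disjoint transitive tournaments on $k$ vertices ("$k$-cliques"; minimal feedback arc sets are acyclic, so every $k$-clique contained in one is transitive). A $k$-partite tournament is an orientation of a complete $k$-partite graph; a random orientation directs each edge independently, each way with probability $1/2$. For a $k$-partite tournament $G$ with vertex classes of sizes $n_1,\dots,n_k$ let $s(G)=\min_i n_i$. Theorem. Fix $k\ge 1$. (a) For every $\varepsilon>0$ there is $N$, depending only on $k$ and $\varepsilon$, such that for all $n_1,\dots,n_k$ with $\min_i n_i\ge N$, a uniformly random $k$-partite tournament $G$ with classes of sizes $n_1,\dots,n_k$ satisfies $f_k(G)=s(G)-k+1$ with probability at least $1-\varepsilon$. (b) Every $k$-partite tournament $G$ satisfies $f_k(G)\le\max(s(G)-k+1,\,0)$. (c) With probability tending to $1$ as $n\to\infty$, a uniformly random $k$-partite tournament $T$ with $n$ vertices in each class has the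 property that every minimal feedback arc set of $T$ contains $n-k+1$ pairwise vertex-disjoint transitive $k$-cliques. (d) With probability tending to $1$ as $n\to\infty$, a uniformly random $k$-partite tournament $T$ with $n$ vertices in each class has the property that for all orderings $\pi$ of its vertices simultaneously, the subgraph $L_\pi(T)$, consisting of all edges $(u,v)$ of $T$ with $\pi(u)<\pi(v)$, contains $n-k+1$ pairwise vertex-disjoint transitive $k$-cliques. (e) With probability tending to $1$ as $n\to\infty$, a uniformly random orientation $G$ of the Turán graph $T(n,k)$ (the complete $k$-partite graph on $n$ vertices with classes as equal as possible) satisfies $f_k(G)=\lfloor n/k\rfloor-k+1$. -/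

import Mathlib

open MeasureTheory ProbabilityTheory Filter Topology

/-- A digraph is acyclic if it has no directed closed walk of positive length
(equivalently, no directed cycle). -/
def IsAcyclicDigraph {V : Type*} (D : Digraph V) : Prop :=
  ∀ v, ¬ Relation.TransGen D.Adj v v

/-- `F` is a feedback arc set of `D`: a spanning subgraph (set of edges of `D`) whose complement
in `D` is acyclic, i.e. a set of edges of `D` that meets every directed cycle of `D`. -/
def IsFeedbackArcSet {V : Type*} (D F : Digraph V) : Prop :=
  F ≤ D ∧ IsAcyclicDigraph (D \ F)

/-- `F` is a minimal feedback arc set of `D` (with respect to inclusion of edge sets). -/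
def IsMinimalFeedbackArcSet {V : Type*} (D F : Digraph V) : Prop :=
  Minimal (IsFeedbackArcSet D) F

/-- `D` contains `m` pairwise vertex-disjoint copies of the digraph `H` as subgraphs. -/
def HasDisjointCopies {W V : Type*} (H : Digraph W) (D : Digraph V) (m : ℕ) : Prop :=
  ∃ c : Fin m → W → V,
    (∀ a, Function.Injective (c a)) ∧
    (∀ a x y, H.Adj x y → D.Adj (c a x) (c a y)) ∧
    (∀ a b, a ≠ b → Disjoint (Set.range (c a)) (Set.range (c b)))

/-- The transitive tournament on `k` vertices: the unique acyclic `k`-clique. -/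
def transitiveTournament (k : ℕ) : Digraph (Fin k) where
  Adj i j := i < j

/-- `f_H(D)`: the largest `m` such that every minimal feedback arc set of `D` contains `m`
pairwise vertex-disjoint copies of `H`. -/
noncomputable def feedbackPackingNumber {W V : Type*} (H : Digraph W) (D : Digraph V) : ℕ :=
  sSup {m : ℕ | ∀ F, IsMinimalFeedbackArcSet D F → HasDisjointCopies H F m}

/-- `f_k(D)`: the parameter `f_H(D)` where `H` is the acyclic `k`-clique. -/
noncomputable def feedbackCliqueNumber {V : Type*} (k : ℕ) (D : Digraph V) : ℕ :=
  feedbackPackingNumber (transitiveTournament k) D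

/-- The spanning subgraph `L_π(D)` of all edges of `D` that go from left to right in the
vertex ordering `π`. -/
def leftToRight {V : Type*} [Fintype V] (D : Digraph V) (π : V ≃ Fin (Fintype.card V)) :
    Digraph V where
  Adj u v := D.Adj u v ∧ π u < π v

/-- The orientations of a simple graph `G`: every edge of `G` receives exactly one of its two
directions, and there are no other arcs. -/
def GraphOrientation {V : Type*} (G : SimpleGraph V) : Type _ :=
  {D : Digraph V // ∀ u v, (D.Adj u v ∨ D.Adj v u ↔ G.Adj u v) ∧ ¬ (D.Adj u v ∧ D.Adj v u)}

instance GraphOrientation.instMeasurableSpace {V : Type*} (G : SimpleGraph V) :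
    MeasurableSpace (GraphOrientation G) := ⊤

instance GraphOrientation.instFinite {V : Type*} [Finite V] (G : SimpleGraph V) :
    Finite (GraphOrientation G) := by
  classical
  have : Fintype V := Fintype.ofFinite V
  exact Finite.of_injective (fun D : GraphOrientation G => D.1) Subtype.val_injective

instance GraphOrientation.instNonempty {V : Type*} [Finite V] (G : SimpleGraph V) :
    Nonempty (GraphOrientation G) := by
  obtain ⟨n, ⟨e⟩⟩ := Finite.exists_equiv_fin V
  refine ⟨⟨⟨fun u v => G.Adj u v ∧ e u < e v⟩, fun u v => ⟨⟨?_, fun h => ?_⟩, ?_⟩⟩⟩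
  · rintro (h | h)
    exacts [h.1, h.1.symm]
  · rcases lt_or_gt_of_ne (fun h' => h.ne (e.injective h')) with h' | h'
    exacts [Or.inl ⟨h, h'⟩, Or.inr ⟨h.symm, h'⟩]
  · rintro ⟨h, h'⟩
    exact lt_asymm h.2 h'.2

/-- The law of a random orientation of `G`: all orientations are equally likely, equivalently
the edges are directed independently, each in either direction with probability `1/2`. -/
noncomputable def randomOrientation {V : Type*} (G : SimpleGraph V) :
    Measure (GraphOrientation G) :=
  uniformOn Set.univ

/-- A random orientation of a finite graph has a probability law. -/
instance randomOrientation.instIsProbabilityMeasure {V : Type*} [Finite V] (G : SimpleGraph V) :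
    IsProbabilityMeasure (randomOrientation G) :=
  inferInstanceAs (IsProbabilityMeasure (uniformOn Set.univ))

/-- The complete `k`-partite graph with vertex classes of sizes `n 0, …, n (k - 1)`. -/
abbrev completePartite {k : ℕ} (n : Fin k → ℕ) : SimpleGraph (Σ i : Fin k, Fin (n i)) :=
  SimpleGraph.completeMultipartiteGraph (fun i => Fin (n i))

/-!
Every feedback arc set contains the graph `L_π(D)` of left-to-right edges of some ordering `π`
(`IsFeedbackArcSet.exists_leftToRight`), so all lower bounds follow from one statement about all
orderings at once: in a random orientation of a graph containing a balanced complete `k`-partite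
graph with classes of size `n`, with high probability every `L_π` contains `n + 1 - k` disjoint
`k`-cliques (`exists_forall_randomOrientation_ge`). For unequal classes one restricts to a part of
size `s(G)` of each class.

There are too many orderings for a union bound over all of them, but two properties hold for all
orderings simultaneously, with `m` about `n ^ (1 / 4)`.

* Expansion (`ExpandsAt`): among any `m` vertices of a class and any `m` disjoint transversals, some
  vertex is adjacent in `L_π` to a whole transversal outside its class. Only the positions of
  `(k + 1) * m` vertices matter, giving `(k * n) ^ O(m)` choices against a failure probability
  `θ ^ (m ^ 2)` with `θ < 1`.
* Few vertices of small degree: in a random orientation any two vertices `v`, `v'` have many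
  common vertices of `N⁺(v)` and `N⁻(v')` in each other class. If `v` precedes `v'` in `π`, each of
  these is an `L_π`-neighbour of `v` or of `v'`. Hence at most one vertex has small degree
  to a given class (`eq_of_small_degree`), and discarding `k - 1` vertices of each class leaves only
  vertices of large degree to all other classes.

A deterministic absorption argument (`ExpandsAt.exists_isPacking`) then gives a perfect packing of
the remaining vertices. Fix a small greedy packing `K₀`. By expansion, all but at most `m`
vertices of each class fit into many cliques of `K₀`, in place of the vertex of their own class.
Cover the exceptional vertices by disjoint cliques inside their large neighbourhoods, and extend
greedily until `O(m)` vertices remain in each class. These fit into many cliques of `K₀`, and one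
remaining vertex of each class can be swapped into a clique of `K₀` in such a way that the `k`
vertices released form another clique.

For the upper bound (`mem_upperBounds_feedbackCliqueNumber`), `k - 1` vertices of a smallest class
are assigned to the `k - 1` other classes, and the ordering is chosen so that no left-to-right edge
joins a vertex to its assigned class.
-/

/-! ### Perfect packings of transversal cliques in expanding multipartite graphs -/

/-- A transversal of the vertex classes `{i} × Fin n` of `Fin k × Fin n`, given by the function
`f` choosing one vertex in each class, spans a clique of `H`. -/
def IsTransversalClique {k n : ℕ} (H : SimpleGraph (Fin k × Fin n)) (f : Fin k → Fin n) : Prop :=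
  ∀ i j, i ≠ j → H.Adj (i, f i) (j, f j)

/-- Expansion at scale `m`: among any `m` vertices of class `i` and any `m` pairwise disjoint
transversals, some vertex is adjacent to all vertices of some transversal outside class `i`. -/
def ExpandsAt {k n : ℕ} (H : SimpleGraph (Fin k × Fin n)) (m : ℕ) : Prop :=
  ∀ (i : Fin k) (x : Fin m → Fin k → Fin n) (w : Fin m → Fin n),
    (∀ j, Function.Injective fun a => x a j) → Function.Injective w →
      ∃ a b, ∀ j, j ≠ i → H.Adj (i, w b) (j, x a j)

/-- The first `T` terms of the sequence `x` are pairwise disjoint transversal cliques of `H` with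
vertices in the sets `B i`. Sequences indexed by `ℕ` are used so that packings can be extended and
modified without changing the type of the index; terms from `T` on are irrelevant. -/
structure IsPacking {k n : ℕ} (H : SimpleGraph (Fin k × Fin n)) (B : Fin k → Finset (Fin n))
    (x : ℕ → Fin k → Fin n) (T : ℕ) : Prop where
  clique : ∀ a < T, IsTransversalClique H (x a)
  mem : ∀ a < T, ∀ i, x a i ∈ B i
  inj : ∀ i, ∀ a < T, ∀ b < T, x a i = x b i → a = b

section Packing

variable {k n m : ℕ} {H : SimpleGraph (Fin k × Fin n)} {B : Fin k → Finset (Fin n)}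

theorem ExpandsAt.exists_adj (hH : ExpandsAt H m) (i : Fin k) {x : ℕ → Fin k → Fin n}
    {S : Finset ℕ} {W : Finset (Fin n)} (hx : ∀ j, ∀ a ∈ S, ∀ b ∈ S, x a j = x b j → a = b)
    (hS : m ≤ S.card) (hW : m ≤ W.card) :
    ∃ a ∈ S, ∃ b ∈ W, ∀ j, j ≠ i → H.Adj (i, b) (j, x a j) := by
  obtain ⟨a, b, h⟩ := hH i (fun a => x (S.orderEmbOfCardLe hS a)) (W.orderEmbOfCardLe hW)
    (fun j a b hab => (S.orderEmbOfCardLe hS).injective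
      (hx j _ (S.orderEmbOfCardLe_mem hS a) _ (S.orderEmbOfCardLe_mem hS b) hab))
    (W.orderEmbOfCardLe hW).injective
  exact ⟨_, S.orderEmbOfCardLe_mem hS a, _, W.orderEmbOfCardLe_mem hW b, h⟩

/-- Greedy matching of transversals with vertices of class `i`, leaving only `m` unmatched. -/
theorem ExpandsAt.exists_matching (hH : ExpandsAt H m) (i : Fin k) {x : ℕ → Fin k → Fin n}
    {S : Finset ℕ} {W : Finset (Fin n)} (hx : ∀ j, ∀ a ∈ S, ∀ b ∈ S, x a j = x b j → a = b) :
    ∀ t : ℕ, t + m ≤ S.card → t + m ≤ W.card → ∃ S' ⊆ S, S'.card = t ∧ ∃ w : ℕ → Fin n,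
      (∀ a ∈ S', ∀ b ∈ S', w a = w b → a = b) ∧
        ∀ a ∈ S', w a ∈ W ∧ ∀ j, j ≠ i → H.Adj (i, w a) (j, x a j) := by
  classical
  intro t
  induction t with
  | zero =>
    intro _ hW
    refine ⟨∅, by simp, by simp, fun a => ?_, by simp, by simp⟩
    exact x a i
  | succ t ih =>
    intro hS hW
    obtain ⟨S', hS', hcard, w, hw, hadj⟩ := ih (by omega) (by omega)
    have h1 : m ≤ (S \ S').card := by
      have := Finset.le_card_sdiff S' S
      omega
    have h2 : m ≤ (W \ S'.image w).card := by
      have := Finset.le_card_sdiff (S'.image w) W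
      have := Finset.card_image_le (s := S') (f := w)
      omega
    obtain ⟨a, ha, b, hb, hab⟩ := hH.exists_adj i (x := x)
      (fun j a ha b hb => hx j a (Finset.sdiff_subset ha) b (Finset.sdiff_subset hb)) h1 h2
    rw [Finset.mem_sdiff] at ha hb
    have hb' : ∀ c ∈ S', w c ≠ b := fun c hc h => hb.2 (Finset.mem_image.2 ⟨c, hc, h⟩)
    have hne : ∀ c ∈ S', c ≠ a := fun c hc h => ha.2 (h ▸ hc)
    refine ⟨insert a S', Finset.insert_subset ha.1 hS', by
      rw [Finset.card_insert_of_notMem ha.2, hcard], Function.update w a b, ?_, ?_⟩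
    · intro c hc e he h
      rcases Finset.mem_insert.1 hc with rfl | hc' <;> rcases Finset.mem_insert.1 he with rfl | he'
      · rfl
      · rw [Function.update_self, Function.update_of_ne (hne e he')] at h
        exact absurd h.symm (hb' e he')
      · rw [Function.update_self, Function.update_of_ne (hne c hc')] at h
        exact absurd h (hb' c hc')
      · rw [Function.update_of_ne (hne e he'), Function.update_of_ne (hne c hc')] at h
        exact hw c hc' e he' h
    · intro c hc
      rcases Finset.mem_insert.1 hc with rfl | hc
      · rw [Function.update_self]
        exact ⟨hb.1, hab⟩
      · rw [Function.update_of_ne (hne c hc)]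
        exact hadj c hc

/-- Large subsets of the classes contain a transversal clique: matching pairwise disjoint partial
cliques on the first `s` classes with the vertices of the next class loses only `m` of them. -/
theorem ExpandsAt.exists_clique (hH : ExpandsAt H m) (hm : 0 < m) {A : Fin k → Finset (Fin n)}
    (hA : ∀ i, (k + 1) * m ≤ (A i).card) : ∃ f, IsTransversalClique H f ∧ ∀ i, f i ∈ A i := by
  classical
  have key : ∀ s ≤ k, ∃ (x : ℕ → Fin k → Fin n) (S : Finset ℕ), (k + 1 - s) * m ≤ S.card ∧
      (∀ j, ∀ a ∈ S, ∀ b ∈ S, x a j = x b j → a = b) ∧ (∀ a ∈ S, ∀ j, x a j ∈ A j) ∧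
      ∀ a ∈ S, ∀ i j : Fin k, i.1 < s → j.1 < s → i ≠ j → H.Adj (i, x a i) (j, x a j) := by
    intro s
    induction s with
    | zero =>
      intro _
      have hpos : 0 < (k + 1) * m := by positivity
      refine ⟨fun a j => (A j).orderEmbOfCardLe (hA j) ⟨a % ((k + 1) * m), Nat.mod_lt _ hpos⟩,
        Finset.range ((k + 1) * m), by simp, ?_, ?_, by simp⟩
      · intro j a ha b hb hab
        have := ((A j).orderEmbOfCardLe (hA j)).injective hab
        rw [Finset.mem_range] at ha hb
        simpa [Nat.mod_eq_of_lt ha, Nat.mod_eq_of_lt hb] using this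
      · intro a _ j
        exact (A j).orderEmbOfCardLe_mem (hA j) _
    | succ s ih =>
      intro hs
      obtain ⟨x, S, hS, hx, hxA, hadj⟩ := ih (by omega)
      have e : k + 1 - s = (k + 1 - (s + 1)) + 1 := by omega
      obtain ⟨S', hS', hcard, w, hw, hwadj⟩ := hH.exists_matching ⟨s, hs⟩ (W := A ⟨s, hs⟩) hx
        ((k + 1 - (s + 1)) * m) (by rw [e] at hS; linarith) (by
          have := hA ⟨s, hs⟩
          have : (k + 1 - (s + 1) + 1) * m ≤ (k + 1) * m := Nat.mul_le_mul_right _ (by omega)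
          linarith)
      refine ⟨fun a => Function.update (x a) ⟨s, hs⟩ (w a), S', hcard.ge, ?_, ?_, ?_⟩
      · intro j a ha b hb hab
        by_cases hj : j = ⟨s, hs⟩
        · subst hj
          exact hw a ha b hb (by simpa using hab)
        · exact hx j a (hS' ha) b (hS' hb) (by simpa [hj] using hab)
      · intro a ha j
        by_cases hj : j = ⟨s, hs⟩
        · subst hj
          simpa using (hwadj a ha).1
        · simpa [hj] using hxA a (hS' ha) j
      · intro a ha i j hi hj hij
        by_cases hi' : i = ⟨s, hs⟩
        · subst hi'
          have := (hwadj a ha).2 j hij.symm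
          simpa [hij.symm] using this
        · by_cases hj' : j = ⟨s, hs⟩
          · subst hj'
            have := ((hwadj a ha).2 i hij).symm
            simpa [hij] using this
          · have hi2 : i.1 ≠ s := fun h => hi' (Fin.ext h)
            have hj2 : j.1 ≠ s := fun h => hj' (Fin.ext h)
            simpa [hi', hj'] using hadj a (hS' ha) i j (by omega) (by omega) hij
  obtain ⟨x, S, hS, -, hxA, hadj⟩ := key k le_rfl
  have : 0 < S.card := by
    have e : k + 1 - k = 1 := by omega
    rw [e] at hS
    omega
  obtain ⟨a, ha⟩ := Finset.card_pos.1 this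
  exact ⟨x a, fun i j hij => hadj a ha i j i.2 j.2 hij, hxA a ha⟩

theorem IsPacking.extend {x : ℕ → Fin k → Fin n} {T : ℕ} (hx : IsPacking H B x T)
    {f : Fin k → Fin n} (hf : IsTransversalClique H f) (hfB : ∀ i, f i ∈ B i)
    (hfx : ∀ i, ∀ a < T, x a i ≠ f i) : IsPacking H B (Function.update x T f) (T + 1) := by
  have hcase : ∀ a < T + 1, a = T ∨ a < T ∧ a ≠ T := by omega
  refine ⟨fun a ha => ?_, fun a ha i => ?_, fun i a ha b hb h => ?_⟩
  · rcases hcase a ha with rfl | ⟨h1, h2⟩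
    · simpa using hf
    · simpa [h2] using hx.clique a h1
  · rcases hcase a ha with rfl | ⟨h1, h2⟩
    · simpa using hfB i
    · simpa [h2] using hx.mem a h1 i
  · rcases hcase a ha with rfl | ⟨h1, h2⟩ <;> rcases hcase b hb with rfl | ⟨h3, h4⟩
    · rfl
    · simp only [Function.update_self, Function.update_of_ne h4] at h
      exact absurd h.symm (hfx i b h3)
    · simp only [Function.update_self, Function.update_of_ne h2] at h
      exact absurd h (hfx i a h1)
    · simp only [Function.update_of_ne h2, Function.update_of_ne h4] at h
      exact hx.inj i a h1 b h3 h

/-- Greedy extension of a packing as long as every class has `(k + 1) * m` free vertices. -/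
theorem IsPacking.exists_extend {x : ℕ → Fin k → Fin n} {T T' : ℕ} (hx : IsPacking H B x T)
    (hH : ExpandsAt H m) (hm : 0 < m) (hT : T ≤ T') (hB : ∀ i, T' + (k + 1) * m ≤ (B i).card) :
    ∃ x', (∀ a < T, x' a = x a) ∧ IsPacking H B x' T' := by
  classical
  induction T', hT using Nat.le_induction with
  | base => exact ⟨x, fun _ _ => rfl, hx⟩
  | succ T' hT ih =>
    obtain ⟨x', hagree, hx'⟩ := ih (fun i => by have := hB i; omega)
    obtain ⟨f, hf, hfA⟩ := hH.exists_clique hm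
      (A := fun i => B i \ (Finset.range T').image (fun a => x' a i)) (fun i => by
        have h1 := Finset.le_card_sdiff ((Finset.range T').image (fun a => x' a i)) (B i)
        have h2 := Finset.card_image_le (s := Finset.range T') (f := fun a => x' a i)
        rw [Finset.card_range] at h2
        have := hB i
        omega)
    simp only [Finset.mem_sdiff, Finset.mem_image, Finset.mem_range, not_exists, not_and] at hfA
    refine ⟨Function.update x' T' f, fun a ha => ?_,
      hx'.extend hf (fun i => (hfA i).1) (fun i a ha => (hfA i).2 a ha)⟩
    rw [Function.update_of_ne (by omega), hagree a ha]

/-- If all degrees between different classes are large, a packing can be extended so as to cover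
a prescribed small set `L` of vertices, one clique for each. -/
theorem IsPacking.exists_cover {x : ℕ → Fin k → Fin n} {T d : ℕ} (hx : IsPacking H B x T)
    (hH : ExpandsAt H m) (hm : 0 < m) (hn : (k + 1) * m ≤ n)
    (hdeg : ∀ i, ∀ v ∈ B i, ∀ j, j ≠ i → ∃ N ⊆ B j, d ≤ N.card ∧ ∀ b ∈ N, H.Adj (i, v) (j, b))
    (L : Finset (Fin k × Fin n)) (hL : ∀ v ∈ L, v.2 ∈ B v.1) (hd : T + L.card + (k + 1) * m ≤ d) :
    ∃ x' T', T ≤ T' ∧ T' ≤ T + L.card ∧ (∀ a < T, x' a = x a) ∧ IsPacking H B x' T' ∧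
      ∀ v ∈ L, ∃ a < T', x' a v.1 = v.2 := by
  classical
  induction L using Finset.induction_on with
  | empty => exact ⟨x, T, le_rfl, by simp, fun _ _ => rfl, hx, by simp⟩
  | insert v L hv ih =>
    rw [Finset.card_insert_of_notMem hv] at hd ⊢
    obtain ⟨x', T', hT, hT', hagree, hx', hcov⟩ :=
      ih (fun u hu => hL u (Finset.mem_insert_of_mem hu)) (by omega)
    by_cases hvc : ∃ a < T', x' a v.1 = v.2
    · refine ⟨x', T', hT, by omega, hagree, hx', fun u hu => ?_⟩
      rcases Finset.mem_insert.1 hu with rfl | hu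
      exacts [hvc, hcov u hu]
    · push Not at hvc
      have hvB := hL v (Finset.mem_insert_self _ _)
      have hN : ∀ j, ∃ N : Finset (Fin n), (k + 1) * m ≤ N.card ∧
          (j ≠ v.1 → ∀ b ∈ N, b ∈ B j ∧ (∀ a < T', x' a j ≠ b) ∧ H.Adj v (j, b)) := by
        intro j
        by_cases hj : j = v.1
        · exact ⟨Finset.univ, by simpa using hn, fun h => absurd hj h⟩
        · obtain ⟨N, hNB, hNd, hN⟩ := hdeg v.1 v.2 hvB j hj
          refine ⟨N \ (Finset.range T').image (fun a => x' a j), ?_, fun _ b hb => ?_⟩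
          · have h1 := Finset.le_card_sdiff ((Finset.range T').image (fun a => x' a j)) N
            have h2 := Finset.card_image_le (s := Finset.range T') (f := fun a => x' a j)
            rw [Finset.card_range] at h2
            omega
          · simp only [Finset.mem_sdiff, Finset.mem_image, Finset.mem_range, not_exists,
              not_and] at hb
            exact ⟨hNB hb.1, hb.2, hN b hb.1⟩
      choose N hNcard hN using hN
      obtain ⟨f, hf, hfN⟩ := hH.exists_clique hm hNcard
      have hclique : IsTransversalClique H (Function.update f v.1 v.2) := by
        intro i j hij
        by_cases hi : i = v.1
        · subst hi
          simpa [hij.symm] using (hN j hij.symm _ (hfN j)).2.2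
        · by_cases hj : j = v.1
          · subst hj
            simpa [hij] using (hN i hij _ (hfN i)).2.2.symm
          · simpa [hi, hj] using hf i j hij
      refine ⟨Function.update x' T' (Function.update f v.1 v.2), T' + 1, by omega, by omega,
        fun a ha => ?_, hx'.extend hclique (fun i => ?_) (fun i a ha => ?_), fun u hu => ?_⟩
      · rw [Function.update_of_ne (by omega), hagree a ha]
      · by_cases hi : i = v.1
        · subst hi
          simpa using hvB
        · simpa [hi] using (hN i hi _ (hfN i)).1
      · by_cases hi : i = v.1
        · subst hi
          simpa using hvc a ha
        · simpa [hi] using (hN i hi _ (hfN i)).2.1 a ha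
      · rcases Finset.mem_insert.1 hu with rfl | hu
        · exact ⟨T', by omega, by simp⟩
        · obtain ⟨a, ha, h⟩ := hcov u hu
          exact ⟨a, by omega, by rw [Function.update_of_ne (by omega), h]⟩

/-- Absorption. The vertex `v` of class `i` fits into the clique `x a` if it may replace the vertex
of class `i` in it. If every vertex outside the packing fits into many of the cliques `x a`,
`a ∈ P`, then the packing can be made perfect: for uncovered vertices `v i`, one in each class,
there are distinct `α i ∈ P` such that `v i` fits into `x (α i)` and the replaced vertices
`x (α i) i` form a transversal clique. -/
theorem IsPacking.exists_perfect (hH : ExpandsAt H m) (hm : 0 < m) (r : ℕ) :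
    ∀ {x : ℕ → Fin k → Fin n} {T : ℕ} {P : Finset ℕ}, IsPacking H B x T →
      (∀ i, (B i).card = T + r) → (∀ a ∈ P, a < T) →
      (∀ i, ∀ v ∈ B i, (∀ a < T, x a i ≠ v) → ∃ D ⊆ P, k * ((k + 1) * m) + k * r ≤ D.card ∧
        ∀ a ∈ D, ∀ j, j ≠ i → H.Adj (i, v) (j, x a j)) →
      ∃ x', IsPacking H B x' (T + r) := by
  classical
  induction r with
  | zero => exact fun hx _ _ _ => ⟨_, hx⟩
  | succ r ih =>
    intro x T P hx hB hP hfit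
    have hv : ∀ i, ∃ v ∈ B i, ∀ a < T, x a i ≠ v := by
      intro i
      by_contra! h
      have : (B i).card ≤ ((Finset.range T).image (fun a => x a i)).card := by
        refine Finset.card_le_card fun v hv => ?_
        obtain ⟨a, ha, hav⟩ := h v hv
        exact Finset.mem_image.2 ⟨a, Finset.mem_range.2 ha, hav⟩
      have h2 := Finset.card_image_le (s := Finset.range T) (f := fun a => x a i)
      rw [Finset.card_range] at h2
      have := hB i
      omega
    choose v hvB hvx using hv
    choose D hDP hDcard hD using fun i => hfit i (v i) (hvB i) (hvx i)
    -- Hall's theorem provides pairwise disjoint `(k + 1) * m`-subsets of the sets `D i`.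
    obtain ⟨e, he, heD⟩ := (Finset.all_card_le_biUnion_card_iff_exists_injective
      (fun p : Fin k × Fin ((k + 1) * m) => D p.1)).1 (by
        intro s
        rcases s.eq_empty_or_nonempty with rfl | ⟨p, hp⟩
        · simp
        · calc s.card ≤ Fintype.card (Fin k × Fin ((k + 1) * m)) := Finset.card_le_univ s
            _ = k * ((k + 1) * m) := by simp
            _ ≤ (D p.1).card := (Nat.le_add_right _ _).trans (hDcard p.1)
            _ ≤ _ := Finset.card_le_card (Finset.subset_biUnion_of_mem
              (fun p : Fin k × Fin ((k + 1) * m) => D p.1) hp))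
    have heT : ∀ p, e p < T := fun p => hP _ (hDP _ (heD p))
    obtain ⟨g, hg, hgA⟩ := hH.exists_clique hm
      (A := fun i => Finset.univ.image (fun c : Fin ((k + 1) * m) => x (e (i, c)) i)) (fun i => by
        rw [Finset.card_image_of_injective]
        · simp
        · intro c c' h
          simpa using he (hx.inj i _ (heT _) _ (heT _) h))
    simp only [Finset.mem_image, Finset.mem_univ, true_and] at hgA
    choose c hc using hgA
    set α : Fin k → ℕ := fun i => e (i, c i) with hα
    have hαinj : ∀ i j, α i = α j → i = j := fun i j h => (Prod.ext_iff.1 (he h)).1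
    have hαT : ∀ i, α i < T := fun i => heT _
    have hαD : ∀ i, α i ∈ D i := fun i => heD (i, c i)
    have hαg : ∀ i, x (α i) i = g i := hc
    clear_value α
    set x' : ℕ → Fin k → Fin n :=
      fun a l => if a = T then g l else if a = α l then v l else x a l with hx'
    have hx'T : x' T = g := by
      funext l
      simp [hx']
    have hx'lt : ∀ a < T, ∀ l, x' a l = if a = α l then v l else x a l := by
      intro a ha l
      have : a ≠ T := by omega
      simp [hx', this]
    clear_value x'
    have hcase : ∀ a < T + 1, a = T ∨ a < T := by omega
    have hpack : IsPacking H B x' (T + 1) := by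
      refine ⟨fun a ha => ?_, fun a ha i => ?_, fun i a ha b hb h => ?_⟩
      · rcases hcase a ha with rfl | ha
        · rwa [hx'T]
        · intro i j hij
          rw [hx'lt a ha i, hx'lt a ha j]
          by_cases hi : a = α i
          · have hj : a ≠ α j := fun hj => hij (hαinj i j (hi.symm.trans hj))
            rw [if_pos hi, if_neg hj]
            exact hD i a (hi ▸ hαD i) j hij.symm
          · by_cases hj : a = α j
            · rw [if_neg hi, if_pos hj]
              exact (hD j a (hj ▸ hαD j) i hij).symm
            · rw [if_neg hi, if_neg hj]
              exact hx.clique a ha i j hij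
      · rcases hcase a ha with rfl | ha
        · rw [hx'T, ← hαg]
          exact hx.mem _ (hαT i) i
        · rw [hx'lt a ha]
          split_ifs
          exacts [hvB i, hx.mem a ha i]
      · rcases hcase a ha with rfl | ha <;> rcases hcase b hb with rfl | hb
        · rfl
        · rw [hx'T, hx'lt b hb, ← hαg] at h
          split_ifs at h with hbi
          · exact absurd h (hvx i _ (hαT i))
          · exact absurd (hx.inj i _ (hαT i) b hb h).symm hbi
        · rw [hx'T, hx'lt a ha, ← hαg] at h
          split_ifs at h with hbi
          · exact absurd h.symm (hvx i _ (hαT i))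
          · exact absurd (hx.inj i a ha _ (hαT i) h) hbi
        · rw [hx'lt a ha, hx'lt b hb] at h
          split_ifs at h with h1 h2 h2
          · rw [h1, h2]
          · exact absurd h.symm (hvx i b hb)
          · exact absurd h (hvx i a ha)
          · exact hx.inj i a ha b hb h
    obtain ⟨y, hy⟩ := ih (P := P \ Finset.univ.image α) hpack (fun i => by rw [hB i]; ring)
      (fun a ha => (hP a (Finset.sdiff_subset ha)).trans (Nat.lt_succ_self T)) (by
        intro i u hu hux
        have hux0 : ∀ a < T, x a i ≠ u := by
          intro a ha h
          by_cases hai : a = α i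
          · apply hux T (Nat.lt_succ_self T)
            rw [hx'T, ← hαg, ← hai, h]
          · apply hux a (by omega)
            rw [hx'lt a ha, if_neg hai, h]
        obtain ⟨E, hEP, hEcard, hE⟩ := hfit i u hu hux0
        refine ⟨E \ Finset.univ.image α, Finset.sdiff_subset_sdiff hEP le_rfl, ?_, ?_⟩
        · have h1 := Finset.le_card_sdiff (Finset.univ.image α) E
          have h2 := Finset.card_image_le (s := Finset.univ) (f := α)
          rw [Finset.card_univ, Fintype.card_fin] at h2
          have : k * (r + 1) = k * r + k := by ring
          omega
        · intro a ha j hj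
          rw [Finset.mem_sdiff] at ha
          have haT := hP a (hEP ha.1)
          rw [hx'lt a haT, if_neg]
          · exact hE a ha.1 j hj
          · exact fun h => ha.2 (Finset.mem_image.2 ⟨j, Finset.mem_univ _, h.symm⟩))
    exact ⟨y, by rwa [show T + (r + 1) = T + 1 + r by ring]⟩

/-- In an expanding graph with large degrees between different classes, the sets `B i` have a
perfect packing by transversal cliques. At most `m` vertices of each class fit into few cliques
of a small greedy packing; these are covered first, the packing is extended greedily, and the
remaining vertices are absorbed into the small packing. -/
theorem ExpandsAt.exists_isPacking (hH : ExpandsAt H m) (hm : 0 < m) {t d : ℕ}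
    (hB : ∀ i, (B i).card = t)
    (hdeg : ∀ i, ∀ v ∈ B i, ∀ j, j ≠ i → ∃ N ⊆ B j, d ≤ N.card ∧ ∀ b ∈ N, H.Adj (i, v) (j, b))
    (hd : 8 * (k + 1) ^ 2 * m ^ 2 ≤ d) (ht : 8 * (k + 1) ^ 2 * m ^ 2 ≤ t) (htn : t ≤ n) :
    ∃ x, IsPacking H B x t := by
  classical
  set K := (k + 1) * m with hK
  -- At the end `K` vertices of each class are left, and absorbing them needs `D` fitting cliques
  -- for each. With `q` cliques to begin with, `m` of them fit none of `m` vertices that fit fewer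
  -- than `D` each, which contradicts expansion.
  set D := k * K + k * K with hD
  set q := m * D + m with hq
  have hbound : q + k * m + K + K ≤ 8 * (k + 1) ^ 2 * m ^ 2 := by
    rw [hq, hD, hK]
    nlinarith [Nat.zero_le (k * m), Nat.zero_le k, Nat.mul_le_mul hm hm,
      Nat.mul_le_mul_left (k * m) hm, Nat.mul_le_mul_left m hm, Nat.zero_le (k * m * m),
      Nat.zero_le (k * k * m * m)]
  have hempty : IsPacking H B (fun _ _ => ⟨0, by
    have : 0 < (k + 1) * m := by positivity
    omega⟩) 0 := ⟨by simp, by simp, by simp⟩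
  obtain ⟨x₀, -, hx₀⟩ := hempty.exists_extend hH hm (Nat.zero_le q) (fun i => by
    rw [hB i]; omega)
  set fit : Fin k → Fin n → Finset ℕ := fun i v =>
    (Finset.range q).filter (fun a => ∀ j, j ≠ i → H.Adj (i, v) (j, x₀ a j)) with hfit
  set atyp : Fin k → Finset (Fin n) := fun i => (B i).filter (fun v => (fit i v).card < D)
    with hatyp
  have hatypcard : ∀ i, (atyp i).card ≤ m := by
    intro i
    by_contra! hlt
    obtain ⟨W, hW, hWcard⟩ := Finset.exists_subset_card_eq hlt.le
    have h1 : (W.biUnion (fit i)).card ≤ m * D := by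
      rw [← hWcard]
      exact Finset.card_biUnion_le_card_mul _ _ _
        (fun w hw => (Finset.mem_filter.1 (hW hw)).2.le)
    have h2 : m ≤ (Finset.range q \ W.biUnion (fit i)).card := by
      have := Finset.le_card_sdiff (W.biUnion (fit i)) (Finset.range q)
      rw [Finset.card_range] at this
      omega
    obtain ⟨a, ha, b, hb, hab⟩ := hH.exists_adj i (x := x₀) (W := W) (fun j a ha b hb =>
      hx₀.inj j a (Finset.mem_range.1 (Finset.sdiff_subset ha)) b
        (Finset.mem_range.1 (Finset.sdiff_subset hb))) h2 hWcard.ge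
    rw [Finset.mem_sdiff] at ha
    exact ha.2 (Finset.mem_biUnion.2 ⟨b, hb, Finset.mem_filter.2 ⟨ha.1, hab⟩⟩)
  set L : Finset (Fin k × Fin n) :=
    Finset.univ.biUnion (fun i => (atyp i).image (fun v => (i, v))) with hL
  have hLcard : L.card ≤ k * m := by
    have := Finset.card_biUnion_le_card_mul (Finset.univ : Finset (Fin k))
      (fun i => (atyp i).image (fun v => (i, v))) m
      (fun i _ => Finset.card_image_le.trans (hatypcard i))
    simpa using this
  have hLmem : ∀ v, v ∈ L ↔ v.2 ∈ atyp v.1 := by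
    rintro ⟨i, v⟩
    simp [hL]
  obtain ⟨x₁, T₁, hqT, hT₁, hagree₁, hx₁, hcov⟩ := hx₀.exists_cover hH hm (by omega) hdeg L
    (fun v hv => (Finset.mem_filter.1 ((hLmem v).1 hv)).1) (by omega)
  obtain ⟨x₂, hagree₂, hx₂⟩ := hx₁.exists_extend hH hm (T' := t - K) (by omega) (fun i => by
    rw [hB i]; omega)
  obtain ⟨x, hx⟩ := IsPacking.exists_perfect hH hm K (P := Finset.range q) hx₂
    (fun i => by rw [hB i]; omega)
    (fun a ha => by rw [Finset.mem_range] at ha; omega) (by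
      intro i v hv hvx
      refine ⟨fit i v, Finset.filter_subset _ _, ?_, ?_⟩
      · by_contra! hlt
        obtain ⟨a, ha, hav⟩ := hcov (i, v) ((hLmem _).2 (Finset.mem_filter.2 ⟨hv, hlt⟩))
        exact hvx a (by omega) (by rw [hagree₂ a ha, hav])
      · intro a ha j hj
        rw [hfit, Finset.mem_filter, Finset.mem_range] at ha
        rw [hagree₂ a (by omega), hagree₁ a ha.1]
        exact ha.2 j hj)
  exact ⟨x, by rwa [show t - K + K = t by omega] at hx⟩

end Packing

/-! ### Patterns on disjoint edge sets of a random orientation -/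

/-- With respect to a linear order on the vertices, an orientation of `G` amounts to a free choice,
for each edge, whether it is directed from its smaller to its larger end. -/
noncomputable def GraphOrientation.equivForwardEdges {V : Type*} [LinearOrder V]
    (G : SimpleGraph V) :
    GraphOrientation G ≃ ({p : V × V // p.1 < p.2 ∧ G.Adj p.1 p.2} → Prop) where
  toFun D p := D.1.Adj p.1.1 p.1.2
  invFun ω :=
    ⟨⟨fun u v => (∃ h : u < v ∧ G.Adj u v, ω ⟨(u, v), h⟩) ∨
      ∃ h : v < u ∧ G.Adj v u, ¬ ω ⟨(v, u), h⟩⟩, by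
      intro u v
      rcases lt_trichotomy u v with h | rfl | h
      · by_cases hG : G.Adj u v
        · simp [h, h.not_gt, hG, hG.symm, em]
        · have hG' : ¬ G.Adj v u := fun h => hG h.symm
          simp [hG, hG']
      · simp
      · by_cases hG : G.Adj v u
        · simp [h, h.not_gt, hG, hG.symm, em']
        · have hG' : ¬ G.Adj u v := fun h => hG h.symm
          simp [hG, hG']⟩
  left_inv D := by
    refine Subtype.ext (Digraph.ext ?_)
    funext u v
    apply propext
    have h1 := D.2 u v
    have h2 : G.Adj u v ↔ G.Adj v u := G.adj_comm u v
    rcases lt_trichotomy u v with h | rfl | h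
    · simp only [h, h.not_gt, true_and, false_and, IsEmpty.exists_iff, or_false, exists_prop]
      tauto
    · simp only [lt_irrefl, false_and, IsEmpty.exists_iff, or_false, false_iff]
      tauto
    · simp only [h, h.not_gt, true_and, false_and, IsEmpty.exists_iff, false_or, exists_prop]
      tauto
  right_inv ω := by
    funext ⟨⟨u, v⟩, h⟩
    have h' : u < v ∧ G.Adj u v := h
    simp [h'.1.not_gt, h']

/-- Avoiding one pattern on each of `Γ` disjoint blocks of `ι` coordinates. -/
theorem card_forall_exists_ne {E Γ ι : Type*} [Fintype E] [Fintype Γ] [Fintype ι]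
    (q : Γ × ι → E) (hq : Function.Injective q) (t : Γ → ι → Prop) :
    (Nat.card {ω : E → Prop | ∀ g, ∃ i, ¬ (ω (q (g, i)) ↔ t g i)} : ℝ) =
      (1 - (1 / 2) ^ Fintype.card ι) ^ Fintype.card Γ * Nat.card (E → Prop) := by
  classical
  let Φ : (E → Prop) ≃ (Γ → ι → Prop) × ({e // ¬ e ∈ Set.range q} → Prop) :=
    (Equiv.piEquivPiSubtypeProd (· ∈ Set.range q) (fun _ => Prop)).trans
      (Equiv.prodCongr (((Equiv.ofInjective q hq).arrowCongr (Equiv.refl Prop)).symm.trans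
        (Equiv.curry Γ ι Prop)) (Equiv.refl _))
  have hΦ : ∀ ω g i, (Φ ω).1 g i = ω (q (g, i)) := fun ω g i => rfl
  have h1 : Nat.card {ω : E → Prop | ∀ g, ∃ i, ¬ (ω (q (g, i)) ↔ t g i)} =
      Nat.card ((Fintype.piFinset fun g => Finset.univ.erase (t g)) ×
        ({e // ¬ e ∈ Set.range q} → Prop)) := by
    refine Nat.card_congr ((Φ.subtypeEquiv (q := fun p => p.1 ∈
      (Fintype.piFinset fun g => Finset.univ.erase (t g))) fun ω => ?_).trans ?_)
    · simp only [Fintype.mem_piFinset, Finset.mem_erase, Finset.mem_univ, and_true, ne_eq,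
        funext_iff, hΦ, not_forall, eq_iff_iff, Set.mem_ofPred_eq]
    · exact (Equiv.prodSubtypeFstEquivSubtypeProd (p := fun f => f ∈
        (Fintype.piFinset fun g => Finset.univ.erase (t g))))
  have h2 : Nat.card (E → Prop) =
      (2 ^ Fintype.card ι) ^ Fintype.card Γ * Nat.card ({e // ¬ e ∈ Set.range q} → Prop) := by
    rw [Nat.card_congr Φ, Nat.card_prod]
    simp
  rw [h1, h2, Nat.card_prod]
  have h3 : (Nat.card (Fintype.piFinset fun g => Finset.univ.erase (t g)) : ℝ) =
      (2 ^ Fintype.card ι - 1) ^ Fintype.card Γ := by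
    rw [Nat.card_eq_fintype_card, Fintype.card_coe, Fintype.card_piFinset]
    have : ∀ g, ((Finset.univ.erase (t g)).card : ℝ) = 2 ^ Fintype.card ι - 1 := by
      intro g
      rw [Finset.cast_card_erase_of_mem (Finset.mem_univ _)]
      simp
    push_cast
    simp only [this, Finset.prod_const, Finset.card_univ]
  push_cast
  rw [h3, ← mul_assoc, ← mul_pow]
  congr 3
  rw [sub_mul, one_mul, ← mul_pow]
  norm_num

theorem randomOrientation_real_eq {V : Type*} [Finite V] (G : SimpleGraph V)
    (s : Set (GraphOrientation G)) :
    (randomOrientation G).real s = (Nat.card s : ℝ) / Nat.card (GraphOrientation G) := by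
  let : Fintype (GraphOrientation G) := Fintype.ofFinite _
  rw [randomOrientation, measureReal_def, uniformOn_univ, Measure.count_apply (by trivial),
    ENNReal.toReal_div, ENNReal.toReal_natCast, ← Nat.card_eq_fintype_card, Nat.card_coe_set_eq,
    ← (Set.toFinite s).cast_ncard_eq,
    ENat.toENNReal_coe, ENNReal.toReal_natCast]

/-- Given families, indexed by `Γ`, of `ι` arcs each along distinct edges, the probability that a
random orientation contains none of the families completely. -/
theorem randomOrientation_forall_exists_not_adj {V Γ ι : Type*} [Finite V] [Fintype Γ] [Fintype ι]
    (G : SimpleGraph V) (u v : Γ → ι → V) (hG : ∀ g i, G.Adj (u g i) (v g i))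
    (hinj : ∀ g i g' i', s(u g i, v g i) = s(u g' i', v g' i') → g = g' ∧ i = i') :
    (randomOrientation G).real {D | ∀ g, ∃ i, ¬ D.1.Adj (u g i) (v g i)} =
      (1 - (1 / 2) ^ Fintype.card ι) ^ Fintype.card Γ := by
  classical
  obtain ⟨N, ⟨e⟩⟩ := Finite.exists_equiv_fin V
  let : LinearOrder V := LinearOrder.lift' e e.injective
  let : Fintype V := Fintype.ofFinite V
  let E := {p : V × V // p.1 < p.2 ∧ G.Adj p.1 p.2}
  let q : Γ × ι → E := fun p => if h : u p.1 p.2 < v p.1 p.2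
    then ⟨(u p.1 p.2, v p.1 p.2), h, hG _ _⟩
    else ⟨(v p.1 p.2, u p.1 p.2), lt_of_le_of_ne (not_lt.1 h) (hG _ _).ne', (hG _ _).symm⟩
  have hqs : ∀ p, s((q p).1.1, (q p).1.2) = s(u p.1 p.2, v p.1 p.2) := by
    intro p
    by_cases h : u p.1 p.2 < v p.1 p.2
    · simp [q, h]
    · simp [q, h, Sym2.eq_swap]
  have hq : Function.Injective q := by
    intro p p' h
    have := hqs p
    rw [h, hqs p'] at this
    obtain ⟨h1, h2⟩ := hinj _ _ _ _ this
    exact Prod.ext h1.symm h2.symm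
  have hcard := card_forall_exists_ne q hq (fun g i => u g i < v g i)
  have hset : Nat.card {D : GraphOrientation G | ∀ g, ∃ i, ¬ D.1.Adj (u g i) (v g i)} =
      Nat.card {ω : E → Prop | ∀ g, ∃ i, ¬ (ω (q (g, i)) ↔ u g i < v g i)} := by
    refine Nat.card_congr ((GraphOrientation.equivForwardEdges G).subtypeEquiv fun D => ?_)
    simp only [Set.mem_ofPred_eq]
    refine forall_congr' fun g => exists_congr fun i => not_congr ?_
    change _ ↔ (D.1.Adj (q (g, i)).1.1 (q (g, i)).1.2 ↔ u g i < v g i)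
    by_cases h : u g i < v g i
    · simp [q, h]
    · have h1 := D.2 (u g i) (v g i)
      have h2 := hG g i
      simp only [q, h, dite_false, iff_false]
      tauto
  rw [← hset] at hcard
  have htot : Nat.card (GraphOrientation G) = Nat.card (E → Prop) :=
    Nat.card_congr (GraphOrientation.equivForwardEdges G)
  have hpos : (0 : ℝ) < Nat.card (E → Prop) := by
    exact_mod_cast Nat.card_pos
  rw [randomOrientation_real_eq, htot, hcard, mul_div_cancel_right₀ _ hpos.ne']

/-! ### The graph of left-to-right edges -/

/-- The undirected graph on `Fin k × Fin n`, placed in `D` by `φ`, of the arcs of `D` directed from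
left to right in the order given by the positions `r`. -/
def forwardGraph {V : Type*} {k n : ℕ} (D : Digraph V) (φ : Fin k × Fin n → V)
    (r : Fin k × Fin n → ℕ) : SimpleGraph (Fin k × Fin n) where
  Adj x y := r x < r y ∧ D.Adj (φ x) (φ y) ∨ r y < r x ∧ D.Adj (φ y) (φ x)
  symm := ⟨fun _ _ h => h.symm⟩
  loopless := ⟨fun x h => by simp at h⟩

/-- `D` contains all the arcs between the vertex `w b` of class `i` and the transversal `x a`
outside class `i`, directed as prescribed by the positions `px` and `pw`. -/
def HasForwardStar {V : Type*} {k n m N : ℕ} (D : Digraph V) (φ : Fin k × Fin n → V) (i : Fin k)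
    (x : Fin m → Fin k → Fin n) (w : Fin m → Fin n) (px : Fin m → Fin k → Fin N)
    (pw : Fin m → Fin N) (a b : Fin m) : Prop :=
  ∀ j : {j // j ≠ i}, D.Adj
    (if px a j < pw b then φ (j, x a j) else φ (i, w b))
    (if px a j < pw b then φ (i, w b) else φ (j, x a j))

/-- Positions may be replaced by ranks, so that only finitely many patterns have to be considered
however large the ambient vertex set is. -/
theorem exists_rank {X : Type*} [Fintype X] {N : ℕ} (hN : Fintype.card X = N) (r : X → ℕ)
    (hr : Function.Injective r) : ∃ ρ : X → Fin N, ∀ x y, ρ x < ρ y ↔ r x < r y := by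
  let : LinearOrder X := LinearOrder.lift' r hr
  let e := Fintype.orderIsoFinOfCardEq X hN
  exact ⟨e.symm, fun x y => e.symm.lt_iff_lt⟩

section ForwardGraph

variable {V : Type*} {k n m : ℕ} {D : Digraph V} {φ : Fin k × Fin n → V} {r : Fin k × Fin n → ℕ}

theorem expandsAt_forwardGraph (hr : Function.Injective r)
    (hD : ∀ (i : Fin k) (x : Fin m → Fin k → Fin n) (w : Fin m → Fin n)
      (px : Fin m → Fin k → Fin (k * n)) (pw : Fin m → Fin (k * n)),
      (∀ j, Function.Injective fun a => x a j) → Function.Injective w →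
        ∃ a b, HasForwardStar D φ i x w px pw a b) :
    ExpandsAt (forwardGraph D φ r) m := by
  intro i x w hx hw
  obtain ⟨ρ, hρ⟩ := exists_rank (N := k * n) (by simp) r hr
  obtain ⟨a, b, hab⟩ := hD i x w (fun a j => ρ (j, x a j)) (fun b => ρ (i, w b)) hx hw
  refine ⟨a, b, fun j hj => ?_⟩
  have h := hab ⟨j, hj⟩
  simp only [hρ] at h
  rcases lt_or_gt_of_ne (a := r (j, x a j)) (b := r (i, w b))
    (fun h => hj (Prod.ext_iff.1 (hr h)).1) with hlt | hlt
  · simp only [if_pos hlt] at h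
    exact Or.inr ⟨hlt, h⟩
  · simp only [if_neg hlt.not_gt] at h
    exact Or.inl ⟨hlt, h⟩

/-- At most one vertex has small degree to the class `j`: if `v` is to the left of `v'`, then every
common vertex of the out-neighbourhood of `v` and the in-neighbourhood of `v'` is adjacent to one
of them, whatever its position. -/
theorem eq_of_small_degree (hr : Function.Injective r) {d : ℕ} {j : Fin k}
    (hD : ∀ v v', v ≠ v' → v.1 ≠ j → v'.1 ≠ j → ∀ S : Finset (Fin n), S.card < 2 * d →
      ∃ b ∉ S, D.Adj (φ v) (φ (j, b)) ∧ D.Adj (φ (j, b)) (φ v'))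
    {v v' : Fin k × Fin n} (hv : v.1 ≠ j) (hv' : v'.1 ≠ j) {S S' : Finset (Fin n)}
    (hS : ∀ b, (forwardGraph D φ r).Adj v (j, b) → b ∈ S) (hSd : S.card < d)
    (hS' : ∀ b, (forwardGraph D φ r).Adj v' (j, b) → b ∈ S') (hSd' : S'.card < d) :
    v = v' := by
  classical
  wlog hlt : r v < r v' generalizing v v' S S'
  · by_contra hne
    exact hne (this hv' hv hS' hSd' hS hSd (lt_of_le_of_ne (not_lt.1 hlt)
      (fun h => hne (hr h).symm))).symm
  by_contra hne
  obtain ⟨b, hb, h1, h2⟩ := hD v v' hne hv hv' (S ∪ S') (by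
    have := Finset.card_union_le S S'
    omega)
  rw [Finset.mem_union, not_or] at hb
  rcases lt_or_gt_of_ne (a := r v) (b := r (j, b)) (fun h => hv (by rw [hr h])) with h | h
  · exact hb.1 (hS b (Or.inl ⟨h, h1⟩))
  · exact hb.2 (hS' b (Or.inr ⟨h.trans hlt, h2⟩))

/-- Discarding `k - 1` vertices of each class, among them all those of small degree to another
class, leaves a perfect packing. -/
theorem exists_isPacking_forwardGraph (hr : Function.Injective r) (hm : 0 < m) {d : ℕ}
    (hstar : ∀ (i : Fin k) (x : Fin m → Fin k → Fin n) (w : Fin m → Fin n)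
      (px : Fin m → Fin k → Fin (k * n)) (pw : Fin m → Fin (k * n)),
      (∀ j, Function.Injective fun a => x a j) → Function.Injective w →
        ∃ a b, HasForwardStar D φ i x w px pw a b)
    (hpath : ∀ j v v', v ≠ v' → v.1 ≠ j → v'.1 ≠ j → ∀ S : Finset (Fin n), S.card < 2 * d →
      ∃ b ∉ S, D.Adj (φ v) (φ (j, b)) ∧ D.Adj (φ (j, b)) (φ v'))
    (hd : 8 * (k + 1) ^ 2 * m ^ 2 + k ≤ d) (hdn : d ≤ n) :
    ∃ (B : Fin k → Finset (Fin n)) (x : ℕ → Fin k → Fin n),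
      IsPacking (forwardGraph D φ r) B x (n + 1 - k) := by
  classical
  set H := forwardGraph D φ r with hH
  set deg : Fin k × Fin n → Fin k → Finset (Fin n) :=
    fun v j => Finset.univ.filter (fun b => H.Adj v (j, b)) with hdeg
  set bad : Fin k → Fin k → Finset (Fin n) :=
    fun i j => Finset.univ.filter (fun a => (deg (i, a) j).card < d) with hbad
  have hbad1 : ∀ i j, j ≠ i → (bad i j).card ≤ 1 := by
    intro i j hj
    refine Finset.card_le_one.2 fun a ha b hb => ?_
    have := eq_of_small_degree (D := D) (φ := φ) hr (hpath j) (v := (i, a)) (v' := (i, b))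
      hj.symm hj.symm (S := deg (i, a) j) (S' := deg (i, b) j)
      (fun c hc => Finset.mem_filter.2 ⟨Finset.mem_univ _, hc⟩) (Finset.mem_filter.1 ha).2
      (fun c hc => Finset.mem_filter.2 ⟨Finset.mem_univ _, hc⟩) (Finset.mem_filter.1 hb).2
    exact (Prod.ext_iff.1 this).2
  have hB : ∀ i, ∃ B : Finset (Fin n), B.card = n + 1 - k ∧
      ∀ a ∈ B, ∀ j, j ≠ i → d ≤ (deg (i, a) j).card := by
    intro i
    have h1 : ((Finset.univ.erase i).biUnion (bad i)).card ≤ k - 1 := by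
      refine (Finset.card_biUnion_le_card_mul _ _ 1
        (fun j hj => hbad1 i j (Finset.ne_of_mem_erase hj))).trans ?_
      simp
    have hk : 0 < k := i.pos
    have h2 : n + 1 - k ≤ (Finset.univ \ (Finset.univ.erase i).biUnion (bad i)).card := by
      have := Finset.le_card_sdiff ((Finset.univ.erase i).biUnion (bad i)) Finset.univ
      rw [Finset.card_univ, Fintype.card_fin] at this
      omega
    obtain ⟨B, hB, hBcard⟩ := Finset.exists_subset_card_eq h2
    refine ⟨B, hBcard, fun a ha j hj => ?_⟩
    by_contra! hlt
    exact (Finset.mem_sdiff.1 (hB ha)).2 (Finset.mem_biUnion.2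
      ⟨j, Finset.mem_erase.2 ⟨hj, Finset.mem_univ _⟩,
        Finset.mem_filter.2 ⟨Finset.mem_univ _, hlt⟩⟩)
  choose B hBcard hB using hB
  rcases Nat.eq_zero_or_pos k with rfl | hk
  · exact ⟨B, fun _ i => i.elim0, fun _ _ i => i.elim0, fun _ _ i => i.elim0, fun i => i.elim0⟩
  have hexp : ExpandsAt H m := expandsAt_forwardGraph hr hstar
  obtain ⟨x, hx⟩ := hexp.exists_isPacking hm (d := d - k) hBcard (fun i v hv j hj =>
    ⟨deg (i, v) j ∩ B j, Finset.inter_subset_right, by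
      have h1 := hB i v hv j hj
      have h2 := Finset.card_inter_add_card_union (deg (i, v) j) (B j)
      have h3 := Finset.card_le_univ (deg (i, v) j ∪ B j)
      rw [Fintype.card_fin] at h3
      have h4 := hBcard j
      omega, fun b hb => (Finset.mem_filter.1 (Finset.mem_inter.1 hb).1).2⟩)
    (by omega) (by omega) (by omega)
  exact ⟨B, x, hx⟩

end ForwardGraph

/-! ### Union bounds -/

section UnionBound

variable {V : Type*} {k n : ℕ} {G : SimpleGraph V} {φ : Fin k × Fin n → V}

theorem randomOrientation_exists_le {I : Type*} [Fintype I] (P : I → GraphOrientation G → Prop)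
    {b : ℝ} (hb : ∀ c, (randomOrientation G).real {D | P c D} ≤ b) :
    (randomOrientation G).real {D | ∃ c, P c D} ≤ Fintype.card I * b := by
  have : {D | ∃ c, P c D} = ⋃ c, {D | P c D} := by
    ext D
    simp
  rw [this]
  refine (measureReal_iUnion_fintype_le _).trans ?_
  refine (Finset.sum_le_sum fun c _ => hb c).trans ?_
  simp

/-- The number of choices of the vertices and positions is `(k * n) ^ O(m)`, while a given choice
fails with probability exponentially small in `m ^ 2`. Only the positions of the `(k + 1) * m`
vertices concerned enter, not the whole ordering. -/
theorem randomOrientation_no_forwardStar_le [Finite V] (hφ : Function.Injective φ)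
    (hG : ∀ x y : Fin k × Fin n, x.1 ≠ y.1 → G.Adj (φ x) (φ y)) (hk : 0 < k) (m : ℕ) :
    (randomOrientation G).real {D | ¬ ∀ (i : Fin k) (x : Fin m → Fin k → Fin n) (w : Fin m → Fin n)
      (px : Fin m → Fin k → Fin (k * n)) (pw : Fin m → Fin (k * n)),
      (∀ j, Function.Injective fun a => x a j) → Function.Injective w →
        ∃ a b, HasForwardStar D.1 φ i x w px pw a b} ≤
      k * (k * n : ℝ) ^ (2 * (k + 1) * m) * (1 - (1 / 2) ^ (k - 1)) ^ (m ^ 2) := by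
  classical
  have hθ : (0 : ℝ) ≤ 1 - (1 / 2) ^ (k - 1) :=
    sub_nonneg.2 (pow_le_one₀ (by norm_num) (by norm_num))
  have key := randomOrientation_exists_le (G := G)
    (I := Fin k × (Fin m → Fin k → Fin n) × (Fin m → Fin n) ×
      (Fin m → Fin k → Fin (k * n)) × (Fin m → Fin (k * n)))
    (fun c D => (∀ j, Function.Injective fun a => c.2.1 a j) ∧ Function.Injective c.2.2.1 ∧
      ∀ a b, ¬ HasForwardStar D.1 φ c.1 c.2.1 c.2.2.1 c.2.2.2.1 c.2.2.2.2 a b)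
    (b := (1 - (1 / 2) ^ (k - 1)) ^ (m ^ 2)) (by
      rintro ⟨i, x, w, px, pw⟩
      by_cases hinj : (∀ j, Function.Injective fun a => x a j) ∧ Function.Injective w
      · have hs : ∀ (g : Fin m × Fin m) (j : {j // j ≠ i}),
            s(if px g.1 j < pw g.2 then φ (j, x g.1 j) else φ (i, w g.2),
              if px g.1 j < pw g.2 then φ (i, w g.2) else φ (j, x g.1 j)) =
            s(φ (j, x g.1 j), φ (i, w g.2)) := by
          intro g j
          split_ifs
          exacts [rfl, Sym2.eq_swap]
        have h := randomOrientation_forall_exists_not_adj G (Γ := Fin m × Fin m)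
          (ι := {j // j ≠ i})
          (fun g j => if px g.1 j < pw g.2 then φ (j, x g.1 j) else φ (i, w g.2))
          (fun g j => if px g.1 j < pw g.2 then φ (i, w g.2) else φ (j, x g.1 j))
          (fun g j => by
            split_ifs
            exacts [hG _ _ j.2, hG _ _ j.2.symm])
          (fun g j g' j' h => by
            rw [hs, hs, Sym2.eq_iff] at h
            rcases h with ⟨h1, h2⟩ | ⟨h1, h2⟩
            · have h1 := Prod.ext_iff.1 (hφ h1)
              have h2 := Prod.ext_iff.1 (hφ h2)
              have hj : j = j' := Subtype.ext h1.1
              subst hj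
              exact ⟨Prod.ext (hinj.1 j h1.2) (hinj.2 h2.2), rfl⟩
            · exact absurd (Prod.ext_iff.1 (hφ h1)).1 j.2)
        have hcard : Fintype.card {j // j ≠ i} = k - 1 := by simp
        rw [hcard, Fintype.card_prod, Fintype.card_fin, ← sq] at h
        rw [← h]
        refine measureReal_mono ?_
        rintro D ⟨-, -, hD⟩ g
        have := hD g.1 g.2
        rw [HasForwardStar, not_forall] at this
        exact this
      · have : {D : GraphOrientation G | (∀ j, Function.Injective fun a => x a j) ∧
            Function.Injective w ∧ ∀ a b, ¬ HasForwardStar D.1 φ i x w px pw a b} = ∅ := by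
          ext D
          simp only [Set.mem_ofPred_eq, Set.mem_empty_iff_false, iff_false]
          exact fun h => hinj ⟨h.1, h.2.1⟩
        simp only [this, measureReal_empty]
        positivity)
  have hcard : (Fintype.card (Fin k × (Fin m → Fin k → Fin n) × (Fin m → Fin n) ×
      (Fin m → Fin k → Fin (k * n)) × (Fin m → Fin (k * n))) : ℝ) ≤
      k * (k * n : ℝ) ^ (2 * (k + 1) * m) := by
    simp only [Fintype.card_prod, Fintype.card_fun, Fintype.card_fin]
    have hn : n ≤ k * n := Nat.le_mul_of_pos_left n hk
    have : k * (((n ^ k) ^ m) * (n ^ m * (((k * n) ^ k) ^ m * (k * n) ^ m))) ≤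
        k * (k * n) ^ (2 * (k + 1) * m) := by
      calc k * (((n ^ k) ^ m) * (n ^ m * (((k * n) ^ k) ^ m * (k * n) ^ m)))
          ≤ k * ((((k * n) ^ k) ^ m) * ((k * n) ^ m * (((k * n) ^ k) ^ m * (k * n) ^ m))) := by
            gcongr
        _ = k * (k * n) ^ (2 * (k + 1) * m) := by ring
    exact_mod_cast this
  refine le_trans (measureReal_mono fun D hD => ?_)
    (key.trans (mul_le_mul_of_nonneg_right hcard (by positivity)))
  simp only [Set.mem_ofPred_eq] at hD ⊢
  push Not at hD
  obtain ⟨i, x, w, px, pw, h1, h2, h3⟩ := hD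
  exact ⟨(i, x, w, px, pw), h1, h2, h3⟩

/-- Fewer than `s` paths of length two from `v` to `v'` through the class `j` means that all of them
pass through some set of at most `s` vertices; the union bound is over these sets. -/
theorem randomOrientation_few_paths_le [Finite V] (hφ : Function.Injective φ)
    (hG : ∀ x y : Fin k × Fin n, x.1 ≠ y.1 → G.Adj (φ x) (φ y)) (hn : 0 < n) (s : ℕ) :
    (randomOrientation G).real {D | ¬ ∀ (j : Fin k) (v v' : Fin k × Fin n), v ≠ v' → v.1 ≠ j →
      v'.1 ≠ j → ∀ S : Finset (Fin n), S.card < s →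
        ∃ b ∉ S, D.1.Adj (φ v) (φ (j, b)) ∧ D.1.Adj (φ (j, b)) (φ v')} ≤
      k * (k * n : ℝ) ^ 2 * (n : ℝ) ^ s * (3 / 4) ^ (n - s) := by
  classical
  have key := randomOrientation_exists_le (G := G)
    (I := Fin k × ((Fin k × Fin n) × (Fin k × Fin n)) × (Fin s → Fin n))
    (fun c D => c.2.1.1 ≠ c.2.1.2 ∧ c.2.1.1.1 ≠ c.1 ∧ c.2.1.2.1 ≠ c.1 ∧
      ∀ b ∉ Set.range c.2.2, ¬ (D.1.Adj (φ c.2.1.1) (φ (c.1, b)) ∧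
        D.1.Adj (φ (c.1, b)) (φ c.2.1.2)))
    (b := (3 / 4) ^ (n - s)) (by
      rintro ⟨j, ⟨v, v'⟩, S⟩
      dsimp only
      by_cases hc : v ≠ v' ∧ v.1 ≠ j ∧ v'.1 ≠ j
      · obtain ⟨hvv, hv, hv'⟩ := hc
        have h := randomOrientation_forall_exists_not_adj G
          (Γ := {b : Fin n // b ∉ Set.range S}) (ι := Bool)
          (fun b t => bif t then φ v else φ (j, b)) (fun b t => bif t then φ (j, b) else φ v')
          (by
            rintro b (_ | _)
            exacts [hG _ _ hv'.symm, hG _ _ hv])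
          (by
            rintro b (_ | _) b' (_ | _) h <;>
              simp only [cond_true, cond_false, Sym2.eq_iff, hφ.eq_iff, Prod.ext_iff,
                true_and, and_true] at h ⊢ <;> grind)
        have hcard : n - s ≤ Fintype.card {b : Fin n // b ∉ Set.range S} := by
          rw [Fintype.card_subtype_compl, Fintype.card_fin]
          exact Nat.sub_le_sub_left ((Fintype.card_le_of_surjective (Set.rangeFactorization S)
            Set.rangeFactorization_surjective).trans (by simp)) n
        have h34 : (1 : ℝ) - (1 / 2) ^ Fintype.card Bool = 3 / 4 := by
          rw [Fintype.card_bool]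
          norm_num
        rw [h34] at h
        refine (measureReal_mono ?_).trans (h.le.trans
          (pow_le_pow_of_le_one (by norm_num) (by norm_num) hcard))
        rintro D ⟨-, -, -, hD⟩ ⟨b, hb⟩
        have := hD b hb
        rw [not_and_or] at this
        rcases this with h | h
        exacts [⟨true, h⟩, ⟨false, h⟩]
      · have : {D : GraphOrientation G | v ≠ v' ∧ v.1 ≠ j ∧ v'.1 ≠ j ∧ ∀ b ∉ Set.range S,
            ¬ (D.1.Adj (φ v) (φ (j, b)) ∧ D.1.Adj (φ (j, b)) (φ v'))} = ∅ := by
          ext D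
          simp only [Set.mem_ofPred_eq, Set.mem_empty_iff_false, iff_false]
          exact fun h => hc ⟨h.1, h.2.1, h.2.2.1⟩
        simp only [this, measureReal_empty]
        positivity)
  refine le_trans (measureReal_mono fun D hD => ?_) (key.trans (le_of_eq ?_))
  · simp only [Set.mem_ofPred_eq] at hD ⊢
    push Not at hD
    obtain ⟨j, v, v', h1, h2, h3, S, hS, h4⟩ := hD
    -- A set of fewer than `s` vertices is contained in the range of a function on `Fin s`.
    obtain ⟨f, hf⟩ : ∃ f : Fin s → Fin n, ∀ b ∈ S, b ∈ Set.range f := by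
      refine ⟨fun a => if h : a.1 < S.card then S.equivFin.symm ⟨a, h⟩ else ⟨0, hn⟩,
        fun b hb => ⟨⟨S.equivFin ⟨b, hb⟩, (S.equivFin ⟨b, hb⟩).2.trans hS⟩, ?_⟩⟩
      simp
    refine ⟨(j, (v, v'), f), h1, h2, h3, fun b hb h => ?_⟩
    exact h4 b (fun hbS => hb (hf b hbS)) h.1 h.2
  · simp only [Fintype.card_prod, Fintype.card_fun, Fintype.card_fin]
    push_cast
    ring

end UnionBound

/-! ### Asymptotics -/

theorem eventually_pow_mul_pow_le_half (c : ℕ) {θ : ℝ} (h0 : 0 ≤ θ) (h1 : θ < 1) :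
    ∀ᶠ m : ℕ in atTop, (m : ℝ) ^ c * θ ^ m ≤ 1 / 2 :=
  (tendsto_pow_const_mul_const_pow_of_abs_lt_one c (by rwa [abs_of_nonneg h0])).eventually_le_const
    (by norm_num)

/-- The two union bounds for `n` close to `m ^ 4`. -/
theorem eventually_union_bounds_le (k C : ℕ) (hk : 0 < k) {ε : ℝ} (hε : 0 < ε) :
    ∀ᶠ m : ℕ in atTop, ∀ n : ℕ, m ^ 4 ≤ n → n < (m + 1) ^ 4 →
      k * (k * n : ℝ) ^ (2 * (k + 1) * m) * (1 - (1 / 2) ^ (k - 1)) ^ (m ^ 2) +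
        k * (k * n : ℝ) ^ 2 * (n : ℝ) ^ (C * m ^ 2) * (3 / 4) ^ (n - C * m ^ 2) ≤ ε := by
  have hθ0 : (0 : ℝ) ≤ 1 - (1 / 2) ^ (k - 1) :=
    sub_nonneg.2 (pow_le_one₀ (by norm_num) (by norm_num))
  have hθ1 : (1 : ℝ) - (1 / 2) ^ (k - 1) < 1 := sub_lt_self _ (by positivity)
  generalize (1 : ℝ) - (1 / 2) ^ (k - 1) = θ at hθ0 hθ1
  filter_upwards [eventually_pow_mul_pow_le_half (5 * (2 * k + 3)) hθ0 hθ1,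
    eventually_pow_mul_pow_le_half (5 * (C + 3)) (θ := 3 / 4) (by norm_num) (by norm_num),
    eventually_ge_atTop (16 * k), eventually_ge_atTop (C + 1), eventually_ge_atTop 1,
    (tendsto_pow_atTop_nhds_zero_of_lt_one (r := (1 / 2 : ℝ)) (by norm_num)
      (by norm_num)).eventually_le_const (half_pos hε)] with m h1 h2 h3 h4 h5 h6 n hn1 hn2
  have hkn : k * n ≤ m ^ 5 := by
    have : (m + 1) ^ 4 ≤ 16 * m ^ 4 := by
      calc (m + 1) ^ 4 ≤ (2 * m) ^ 4 := by gcongr; omega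
        _ = 16 * m ^ 4 := by ring
    calc k * n ≤ k * (16 * m ^ 4) := by gcongr; omega
      _ = 16 * k * m ^ 4 := by ring
      _ ≤ m * m ^ 4 := by gcongr
      _ = m ^ 5 := by ring
  have hkle : k ≤ m ^ 5 := by
    calc k ≤ 16 * k := by omega
      _ ≤ m := h3
      _ ≤ m ^ 5 := Nat.le_self_pow (by norm_num) m
  have hnle : n ≤ m ^ 5 := (Nat.le_mul_of_pos_left n hk).trans hkn
  have hknR : (k * n : ℝ) ≤ m ^ 5 := by exact_mod_cast hkn
  have hkR : (k : ℝ) ≤ m ^ 5 := by exact_mod_cast hkle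
  have hnR : (n : ℝ) ≤ m ^ 5 := by exact_mod_cast hnle
  have hm1 : (1 : ℝ) ≤ m ^ 5 := one_le_pow₀ (by exact_mod_cast h5)
  have hb1 : k * (k * n : ℝ) ^ (2 * (k + 1) * m) * θ ^ (m ^ 2) ≤ ε / 2 := by
    calc k * (k * n : ℝ) ^ (2 * (k + 1) * m) * θ ^ (m ^ 2)
        ≤ m ^ 5 * ((m : ℝ) ^ 5) ^ (2 * (k + 1) * m) * θ ^ (m ^ 2) := by gcongr
      _ = ((m : ℝ) ^ 5) ^ (1 + 2 * (k + 1) * m) * θ ^ (m ^ 2) := by ring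
      _ ≤ ((m : ℝ) ^ 5) ^ ((2 * k + 3) * m) * θ ^ (m ^ 2) := by
        gcongr
        nlinarith
      _ = ((m : ℝ) ^ (5 * (2 * k + 3)) * θ ^ m) ^ m := by
        rw [mul_pow, ← pow_mul, ← pow_mul, ← pow_mul, sq, mul_assoc 5]
      _ ≤ (1 / 2) ^ m := by gcongr
      _ ≤ ε / 2 := h6
  have hexp : m * m ^ 2 ≤ n - C * m ^ 2 := by
    have : m * m ^ 2 + C * m ^ 2 ≤ m ^ 4 := by
      have h7 : m + C ≤ m * m := by nlinarith
      calc m * m ^ 2 + C * m ^ 2 = (m + C) * m ^ 2 := by ring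
        _ ≤ m * m * m ^ 2 := by gcongr
        _ = m ^ 4 := by ring
    omega
  have hb2 : k * (k * n : ℝ) ^ 2 * (n : ℝ) ^ (C * m ^ 2) * (3 / 4) ^ (n - C * m ^ 2) ≤ ε / 2 := by
    calc k * (k * n : ℝ) ^ 2 * (n : ℝ) ^ (C * m ^ 2) * (3 / 4) ^ (n - C * m ^ 2)
        ≤ m ^ 5 * ((m : ℝ) ^ 5) ^ 2 * ((m : ℝ) ^ 5) ^ (C * m ^ 2) * (3 / 4) ^ (m * m ^ 2) := by
          have : ((3 : ℝ) / 4) ^ (n - C * m ^ 2) ≤ (3 / 4) ^ (m * m ^ 2) :=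
            pow_le_pow_of_le_one (by norm_num) (by norm_num) hexp
          gcongr
      _ = ((m : ℝ) ^ 5) ^ (3 + C * m ^ 2) * (3 / 4) ^ (m * m ^ 2) := by ring
      _ ≤ ((m : ℝ) ^ 5) ^ ((C + 3) * m ^ 2) * (3 / 4) ^ (m * m ^ 2) := by
        gcongr
        nlinarith [Nat.mul_le_mul h5 h5]
      _ = ((m : ℝ) ^ (5 * (C + 3)) * (3 / 4) ^ m) ^ (m ^ 2) := by
        rw [mul_pow, ← pow_mul, ← pow_mul, ← pow_mul, mul_assoc 5]
      _ ≤ (1 / 2) ^ (m ^ 2) := by gcongr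
      _ ≤ (1 / 2) ^ m :=
        pow_le_pow_of_le_one (by norm_num) (by norm_num) (Nat.le_self_pow (by norm_num) m)
      _ ≤ ε / 2 := h6
  linarith

/-! ### Disjoint transitive cliques for all orderings simultaneously -/

theorem IsPacking.hasDisjointCopies {V : Type*} {k n T : ℕ} {D F : Digraph V}
    {φ : Fin k × Fin n → V} (hφ : Function.Injective φ) {r : Fin k × Fin n → ℕ}
    (hr : Function.Injective r)
    (hF : ∀ x y, r x < r y → D.Adj (φ x) (φ y) → F.Adj (φ x) (φ y))
    {B : Fin k → Finset (Fin n)} {x : ℕ → Fin k → Fin n}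
    (hx : IsPacking (forwardGraph D φ r) B x T) :
    HasDisjointCopies (transitiveTournament k) F T := by
  let σ : ℕ → Equiv.Perm (Fin k) := fun a => Tuple.sort (fun i => r (i, x a i))
  have hσ : ∀ a, StrictMono (fun l => r (σ a l, x a (σ a l))) := fun a =>
    (Tuple.monotone_sort (fun i => r (i, x a i))).strictMono_of_injective fun l l' h =>
      (σ a).injective (Prod.ext_iff.1 (hr h)).1
  refine ⟨fun a l => φ (σ a l, x a (σ a l)), fun a l l' h => ?_, fun a l l' h => ?_,
    fun a b hab => Set.disjoint_left.2 ?_⟩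
  · exact (σ a).injective (Prod.ext_iff.1 (hφ h)).1
  · have hlt : l < l' := h
    refine hF _ _ (hσ a hlt) ?_
    rcases hx.clique a a.2 (σ a l) (σ a l') ((σ a).injective.ne hlt.ne) with h | h
    · exact h.2
    · exact absurd h.1 (hσ a hlt).not_gt
  · rintro _ ⟨l, rfl⟩ ⟨l', h⟩
    have h := Prod.ext_iff.1 (hφ h)
    have h1 : σ b l' = σ a l := h.1
    have h2 : x b (σ b l') = x a (σ a l) := h.2
    rw [h1] at h2
    exact hab (Fin.ext (hx.inj _ a a.2 b b.2 h2.symm))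

/-- The core of the argument, for a random orientation of any graph containing a balanced complete
`k`-partite graph with classes of size `n`. -/
theorem exists_forall_randomOrientation_ge (k : ℕ) (hk : 0 < k) {ε : ℝ} (hε : 0 < ε) :
    ∃ N : ℕ, k ≤ N ∧ ∀ n, N ≤ n → ∀ (V : Type) [Fintype V] (G : SimpleGraph V)
      (φ : Fin k × Fin n → V), Function.Injective φ →
      (∀ x y : Fin k × Fin n, x.1 ≠ y.1 → G.Adj (φ x) (φ y)) →
      1 - ε ≤ (randomOrientation G).real
        {D | ∀ π, HasDisjointCopies (transitiveTournament k) (leftToRight D.1 π) (n + 1 - k)} := by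
  set C := 8 * (k + 1) ^ 2 + k with hC
  obtain ⟨M, hM⟩ := eventually_atTop.1 ((eventually_union_bounds_le k (2 * C) hk hε).and
    (eventually_ge_atTop (C + 1)))
  refine ⟨M ^ 4 + k, by omega, fun n hn V _ G φ hφ hG => ?_⟩
  set m := Nat.sqrt (Nat.sqrt n) with hm
  have hm1 : m ^ 4 ≤ n := by
    calc m ^ 4 = (m ^ 2) ^ 2 := by ring
      _ ≤ (Nat.sqrt n) ^ 2 := Nat.pow_le_pow_left (Nat.sqrt_le' _) 2
      _ ≤ n := Nat.sqrt_le' n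
  have hm2 : n < (m + 1) ^ 4 := by
    calc n < (Nat.sqrt n + 1) ^ 2 := Nat.lt_succ_sqrt' n
      _ ≤ ((m + 1) ^ 2) ^ 2 := Nat.pow_le_pow_left (Nat.lt_succ_sqrt' _) 2
      _ = (m + 1) ^ 4 := by ring
  have hMm : M ≤ m := by
    by_contra! h
    have : (m + 1) ^ 4 ≤ M ^ 4 := Nat.pow_le_pow_left h 4
    omega
  obtain ⟨hbound, hCm⟩ := hM m hMm
  have hCm : C + 1 ≤ m := hCm
  have hdn : C * m ^ 2 ≤ n := by
    calc C * m ^ 2 ≤ m ^ 2 * m ^ 2 := by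
          gcongr
          nlinarith
      _ = m ^ 4 := by ring
      _ ≤ n := hm1
  have hm0 : 0 < m := by omega
  have hn0 : 0 < n := lt_of_lt_of_le (by positivity) hm1
  have hb1 := randomOrientation_no_forwardStar_le hφ hG hk m
  have hb2 := randomOrientation_few_paths_le hφ hG hn0 (2 * C * m ^ 2)
  have hb := hbound n hm1 hm2
  set A₁ := {D : GraphOrientation G | ¬ ∀ (i : Fin k) (x : Fin m → Fin k → Fin n)
    (w : Fin m → Fin n) (px : Fin m → Fin k → Fin (k * n)) (pw : Fin m → Fin (k * n)),
      (∀ j, Function.Injective fun a => x a j) → Function.Injective w →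
        ∃ a b, HasForwardStar D.1 φ i x w px pw a b} with hA₁
  set A₂ := {D : GraphOrientation G | ¬ ∀ (j : Fin k) (v v' : Fin k × Fin n), v ≠ v' → v.1 ≠ j →
      v'.1 ≠ j → ∀ S : Finset (Fin n), S.card < 2 * C * m ^ 2 →
        ∃ b ∉ S, D.1.Adj (φ v) (φ (j, b)) ∧ D.1.Adj (φ (j, b)) (φ v')} with hA₂
  have hsub : (A₁ ∪ A₂)ᶜ ⊆ {D : GraphOrientation G | ∀ π,
      HasDisjointCopies (transitiveTournament k) (leftToRight D.1 π) (n + 1 - k)} := by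
    intro D hD π
    rw [Set.mem_compl_iff, Set.mem_union, not_or, hA₁, hA₂, Set.mem_ofPred_eq, Set.mem_ofPred_eq,
      not_not, not_not] at hD
    have hr : Function.Injective (fun x => (π (φ x) : ℕ)) :=
      Fin.val_injective.comp (π.injective.comp hφ)
    obtain ⟨B, x, hx⟩ := exists_isPacking_forwardGraph (d := C * m ^ 2) hr hm0 hD.1
      (by simpa only [mul_assoc] using hD.2) (by
        rw [hC, add_mul]
        nlinarith [Nat.mul_le_mul hm0 hm0]) hdn
    exact hx.hasDisjointCopies hφ hr (fun x y hxy hadj => ⟨hadj, hxy⟩)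
  refine le_trans ?_ (measureReal_mono hsub)
  rw [probReal_compl_eq_one_sub (by trivial)]
  have := measureReal_union_le (μ := randomOrientation G) A₁ A₂
  linarith

/-! ### Feedback arc sets and orderings -/

theorem HasDisjointCopies.mono {W V : Type*} {H : Digraph W} {D D' : Digraph V} {m : ℕ}
    (h : HasDisjointCopies H D m) (hD : ∀ u v, D.Adj u v → D'.Adj u v) :
    HasDisjointCopies H D' m := by
  obtain ⟨c, h1, h2, h3⟩ := h
  exact ⟨c, h1, fun a x y hxy => hD _ _ (h2 a x y hxy), h3⟩

/-- Every feedback arc set contains all the left-to-right edges of some ordering, namely the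
reverse of a topological ordering of its complement. -/
theorem IsFeedbackArcSet.exists_leftToRight {V : Type*} [Fintype V] {D F : Digraph V}
    (hF : IsFeedbackArcSet D F) :
    ∃ π : V ≃ Fin (Fintype.card V), ∀ u v, (leftToRight D π).Adj u v → F.Adj u v := by
  classical
  let : PartialOrder V :=
    { le := fun u v => Relation.ReflTransGen (D \ F).Adj v u
      le_refl := fun _ => .refl
      le_trans := fun _ _ _ h h' => h'.trans h
      le_antisymm := fun u v h h' => by
        rcases Relation.reflTransGen_iff_eq_or_transGen.1 h with h | h
        · exact h
        · exact absurd (h.trans_left h') (hF.2 v) }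
  let : Fintype (LinearExtension V) := inferInstanceAs (Fintype V)
  let e := Fintype.orderIsoFinOfCardEq (LinearExtension V) (k := Fintype.card V) rfl
  refine ⟨e.symm.toEquiv, fun u v h => ?_⟩
  by_contra hFuv
  have hle : v ≤ u := Relation.ReflTransGen.single (show (D \ F).Adj u v from ⟨h.1, hFuv⟩)
  exact absurd h.2 (e.symm.monotone (toLinearExtension.monotone hle)).not_gt

/-- Lower bounds for all the graphs `L_π(D)` carry over to all minimal feedback arc sets. -/
theorem HasDisjointCopies.of_leftToRight {W V : Type*} [Fintype V] {H : Digraph W} {D : Digraph V}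
    {m : ℕ} (h : ∀ π, HasDisjointCopies H (leftToRight D π) m) {F : Digraph V}
    (hF : IsMinimalFeedbackArcSet D F) : HasDisjointCopies H F m := by
  obtain ⟨π, hπ⟩ := hF.1.exists_leftToRight
  exact (h π).mono hπ

/-! ### The upper bound -/

/-- Choose `min s (k - 1)` vertices of the class `j` and assign to them distinct other classes.
Placing these vertices in the middle, to the right of the out-neighbours and to the left of the
in-neighbours in the assigned classes, no left-to-right edge joins a chosen vertex to its assigned
class, so no chosen vertex lies in a `k`-clique of left-to-right edges. -/
theorem mem_upperBounds_feedbackCliqueNumber {V : Type*} [Finite V] {k : ℕ} {G : SimpleGraph V}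
    (c : V → Fin k) (hc : ∀ u v, G.Adj u v → c u ≠ c v) (D : GraphOrientation G) (j : Fin k)
    {s : ℕ} (hs : Nat.card {v // c v = j} ≤ s) :
    s + 1 - k ∈ upperBounds {m : ℕ | ∀ F, IsMinimalFeedbackArcSet D.1 F →
      HasDisjointCopies (transitiveTournament k) F m} := by
  classical
  let : Fintype V := Fintype.ofFinite V
  set C : Finset V := Finset.univ.filter (fun v => c v = j) with hC
  have hCs : C.card ≤ s := by
    rwa [Nat.card_eq_fintype_card, Fintype.card_subtype] at hs
  obtain ⟨Z, hZ, hZcard⟩ := Finset.exists_subset_card_eq (Nat.min_le_left C.card (k - 1))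
  obtain ⟨J, hJ, hJcard⟩ := Finset.exists_subset_card_eq (s := Finset.univ.erase j)
    (n := min C.card (k - 1)) (by simp)
  let e : Z ≃ J := Finset.equivOfCardEq (hZcard.trans hJcard.symm)
  let r : V → ℕ := fun x => if h : c x ∈ J then
    (if D.1.Adj (e.symm ⟨c x, h⟩) x then 0 else 2) else 1
  have hFAS : IsFeedbackArcSet D.1 ⟨fun u v => D.1.Adj u v ∧ r u ≤ r v⟩ := by
    refine ⟨fun u v h => h.1, fun v hv => ?_⟩
    have hlt : ∀ u v, Relation.TransGen
        (D.1 \ (⟨fun u v => D.1.Adj u v ∧ r u ≤ r v⟩ : Digraph V)).Adj u v → r v < r u := by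
      intro u v h
      induction h with
      | single h => exact not_le.1 fun hle => h.2 ⟨h.1, hle⟩
      | tail _ h ih => exact (not_le.1 fun hle => h.2 ⟨h.1, hle⟩).trans ih
    exact lt_irrefl _ (hlt v v hv)
  -- The arcs inside a level of `r` all belong to this set, so no linear order is needed.
  obtain ⟨F, hFle, hF⟩ := exists_minimal_le_of_wellFoundedLT (IsFeedbackArcSet D.1) _ hFAS
  intro m hm
  obtain ⟨p, -, hp, hdisj⟩ := hm F hF
  have hadj : ∀ a x y, x ≠ y → ∃ u v, (u = p a x ∧ v = p a y ∨ u = p a y ∧ v = p a x) ∧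
      D.1.Adj u v ∧ r u ≤ r v := by
    intro a x y hxy
    rcases lt_or_gt_of_ne hxy with h | h
    · exact ⟨_, _, Or.inl ⟨rfl, rfl⟩, hFle (hp a x y h)⟩
    · exact ⟨_, _, Or.inr ⟨rfl, rfl⟩, hFle (hp a y x h)⟩
  have hinj : ∀ a, Function.Injective (fun x => c (p a x)) := by
    intro a x y hxy
    by_contra hne
    obtain ⟨u, v, huv, hD, -⟩ := hadj a x y hne
    have := hc u v ((D.2 u v).1.1 (Or.inl hD))
    rcases huv with ⟨rfl, rfl⟩ | ⟨rfl, rfl⟩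
    exacts [this hxy, this hxy.symm]
  have hsurj : ∀ a i, ∃ x, c (p a x) = i := fun a =>
    Finite.injective_iff_surjective.1 (hinj a)
  choose x hx using fun a => hsurj a j
  have hmem : ∀ a, p a (x a) ∈ C \ Z := by
    intro a
    refine Finset.mem_sdiff.2 ⟨Finset.mem_filter.2 ⟨Finset.mem_univ _, hx a⟩, fun hZa => ?_⟩
    obtain ⟨y, hy⟩ := hsurj a (e ⟨_, hZa⟩).1
    have hJy : c (p a y) ∈ J := hy ▸ (e ⟨_, hZa⟩).2
    have hjJ : j ∉ J := fun h => by simpa using hJ h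
    have hxy : x a ≠ y := by
      rintro rfl
      exact hjJ (hx a ▸ hJy)
    have he : e.symm ⟨c (p a y), hJy⟩ = ⟨_, hZa⟩ := by
      rw [Equiv.symm_apply_eq]
      exact Subtype.ext hy
    have hr1 : r (p a (x a)) = 1 := by
      simp only [r, hx a, hjJ, dite_false]
    have hr2 : r (p a y) = if D.1.Adj (p a (x a)) (p a y) then 0 else 2 := by
      simp only [r, hJy, dite_true, he]
    obtain ⟨u, v, huv, hD, hle⟩ := hadj a _ _ hxy
    rcases huv with ⟨rfl, rfl⟩ | ⟨rfl, rfl⟩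
    · rw [hr1, hr2, if_pos hD] at hle
      omega
    · rw [hr1, hr2, if_neg (fun h => (D.2 _ _).2 ⟨h, hD⟩)] at hle
      omega
  have hcard : m ≤ (C \ Z).card := by
    have := Finset.card_le_card_of_injOn (s := Finset.univ) (t := C \ Z) (fun a => p a (x a))
      (fun a _ => hmem a) (fun a _ b _ hab => by
        by_contra hne
        exact Set.disjoint_left.1 (hdisj a b hne) ⟨x a, rfl⟩ ⟨x b, hab.symm⟩)
    simpa using this
  rw [Finset.card_sdiff_of_subset hZ, hZcard] at hcard
  have := j.pos
  omega

theorem feedbackCliqueNumber_le {V : Type*} [Finite V] {k : ℕ} {G : SimpleGraph V}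
    (c : V → Fin k) (hc : ∀ u v, G.Adj u v → c u ≠ c v) (D : GraphOrientation G) (j : Fin k)
    {s : ℕ} (hs : Nat.card {v // c v = j} ≤ s) : feedbackCliqueNumber k D.1 ≤ s + 1 - k :=
  csSup_le' (mem_upperBounds_feedbackCliqueNumber c hc D j hs)

theorem feedbackCliqueNumber_eq {V : Type*} [Fintype V] {k : ℕ} {G : SimpleGraph V}
    (c : V → Fin k) (hc : ∀ u v, G.Adj u v → c u ≠ c v) (D : GraphOrientation G) (j : Fin k)
    {s : ℕ} (hs : Nat.card {v // c v = j} ≤ s)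
    (hD : ∀ π, HasDisjointCopies (transitiveTournament k) (leftToRight D.1 π) (s + 1 - k)) :
    feedbackCliqueNumber k D.1 = s + 1 - k :=
  (feedbackCliqueNumber_le c hc D j hs).antisymm
    (le_csSup ⟨_, mem_upperBounds_feedbackCliqueNumber c hc D j hs⟩
      fun _ hF => HasDisjointCopies.of_leftToRight hD hF)

theorem card_sigma_fst_eq_le {k : ℕ} (n : Fin k → ℕ) (j : Fin k) :
    Nat.card {v : Σ i, Fin (n i) // v.1 = j} ≤ n j := by
  rw [Nat.card_congr (Equiv.sigmaSubtype j)]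
  simp

/-! ### The main theorem -/

theorem tendsto_randomOrientation_one {V : ℕ → Type*} [∀ n, Finite (V n)]
    {G : ∀ n, SimpleGraph (V n)} {A : ∀ n, Set (GraphOrientation (G n))}
    (h : ∀ ε : ℝ, 0 < ε → ∃ N, ∀ n, N ≤ n → 1 - ε ≤ (randomOrientation (G n)).real (A n)) :
    Tendsto (fun n => (randomOrientation (G n)).real (A n)) atTop (𝓝 1) := by
  rw [Metric.tendsto_atTop]
  intro ε hε
  obtain ⟨N, hN⟩ := h (ε / 2) (half_pos hε)
  refine ⟨N, fun n hn => ?_⟩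
  have h1 := hN n hn
  have h2 : (randomOrientation (G n)).real (A n) ≤ 1 := measureReal_le_one
  rw [Real.dist_eq, abs_lt]
  constructor <;> linarith

theorem theorem1 (k : ℕ) (hk : 1 ≤ k) :
    -- the main result: `f_k(G) = s(G) - k + 1` with probability `1 - o(1)` as `s(G) → ∞`
    (∀ ε : ℝ, 0 < ε → ∃ N : ℕ, ∀ n : Fin k → ℕ, N ≤ ⨅ i, n i →
      1 - ε ≤ (randomOrientation (completePartite n)).real
        {G | (feedbackCliqueNumber k G.1 : ℤ) = ((⨅ i, n i : ℕ) : ℤ) - (k : ℤ) + 1}) ∧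
    -- the upper bound, valid for every `k`-partite tournament
    (∀ (n : Fin k → ℕ) (G : GraphOrientation (completePartite n)),
      (feedbackCliqueNumber k G.1 : ℤ) ≤ max (((⨅ i, n i : ℕ) : ℤ) - (k : ℤ) + 1) 0) ∧
    -- equal parts: every minimal feedback arc set has `n - k + 1` disjoint transitive `k`-cliques
    Tendsto (fun n : ℕ => (randomOrientation (completePartite (fun _ : Fin k => n))).real
        {T | ∀ F, IsMinimalFeedbackArcSet T.1 F →
          HasDisjointCopies (transitiveTournament k) F (n + 1 - k)}) atTop (𝓝 1) ∧
    -- equal parts: the same for `L_π(T)`, for all vertex orderings `π` at once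
    Tendsto (fun n : ℕ => (randomOrientation (completePartite (fun _ : Fin k => n))).real
        {T | ∀ π, HasDisjointCopies (transitiveTournament k) (leftToRight T.1 π) (n + 1 - k)})
      atTop (𝓝 1) ∧
    -- random orientations of the Turán graph `T(n, k)`
    Tendsto (fun n : ℕ => (randomOrientation (SimpleGraph.turanGraph n k)).real
        {G | (feedbackCliqueNumber k G.1 : ℤ) = ((n / k : ℕ) : ℤ) - (k : ℤ) + 1})
      atTop (𝓝 1) := by
  have : NeZero k := ⟨by omega⟩
  have hcolor : ∀ (n : Fin k → ℕ) (u v : Σ i, Fin (n i)),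
      (completePartite n).Adj u v → u.1 ≠ v.1 := fun n u v h => h
  have hmin : ∀ n : Fin k → ℕ, ∃ j, n j = ⨅ i, n i := fun n => ciInf_mem n
  have hlower : ∀ ε : ℝ, 0 < ε → ∃ N, ∀ n, N ≤ n →
      1 - ε ≤ (randomOrientation (completePartite (fun _ : Fin k => n))).real
        {T | ∀ π, HasDisjointCopies (transitiveTournament k) (leftToRight T.1 π) (n + 1 - k)} := by
    intro ε hε
    obtain ⟨N, -, hN⟩ := exists_forall_randomOrientation_ge k hk hε
    refine ⟨N, fun n hn => hN n hn _ _ (fun x => ⟨x.1, x.2⟩) (fun x y h => ?_) fun x y h => h⟩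
    simpa [Prod.ext_iff] using h
  refine ⟨fun ε hε => ?_, fun n G => ?_, tendsto_randomOrientation_one fun ε hε => ?_,
    tendsto_randomOrientation_one hlower, tendsto_randomOrientation_one fun ε hε => ?_⟩
  · obtain ⟨N, hkN, hN⟩ := exists_forall_randomOrientation_ge k hk hε
    refine ⟨N, fun n hn => ?_⟩
    obtain ⟨j, hj⟩ := hmin n
    refine (hN _ hn _ (completePartite n)
      (fun x => ⟨x.1, Fin.castLE (ciInf_le' n x.1) x.2⟩) (fun x y h => ?_)
      fun x y h => h).trans (measureReal_mono fun D hD => ?_)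
    · obtain ⟨x1, x2⟩ := x
      obtain ⟨y1, y2⟩ := y
      simp only [Sigma.mk.injEq] at h
      obtain ⟨rfl, h⟩ := h
      rw [heq_eq_eq] at h
      rw [Fin.castLE_injective _ h]
    · have h := feedbackCliqueNumber_eq (fun v => v.1) (hcolor n) D j
        ((card_sigma_fst_eq_le n j).trans hj.le) hD
      simp only [Set.mem_ofPred_eq, h]
      omega
  · obtain ⟨j, hj⟩ := hmin n
    have h := feedbackCliqueNumber_le (fun v => v.1) (hcolor n) G j
      ((card_sigma_fst_eq_le n j).trans hj.le)
    omega
  · obtain ⟨N, hN⟩ := hlower ε hε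
    exact ⟨N, fun n hn => (hN n hn).trans
      (measureReal_mono fun D hD F hF => HasDisjointCopies.of_leftToRight hD hF)⟩
  · obtain ⟨N, hkN, hN⟩ := exists_forall_randomOrientation_ge k hk hε
    refine ⟨N * k, fun n hn => ?_⟩
    have hnk : N ≤ n / k := (Nat.le_div_iff_mul_le hk).2 hn
    have hlt : ∀ x : Fin k × Fin (n / k), x.1.1 + k * x.2.1 < n := by
      intro x
      calc x.1.1 + k * x.2.1 < k * (x.2.1 + 1) := by
            have := x.1.2
            rw [mul_add]
            omega
        _ ≤ k * (n / k) := Nat.mul_le_mul_left k x.2.2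
        _ ≤ n := Nat.mul_div_le n k
    have hmod : ∀ x : Fin k × Fin (n / k), (x.1.1 + k * x.2.1) % k = x.1.1 := fun x => by
      rw [Nat.add_mul_mod_self_left, Nat.mod_eq_of_lt x.1.2]
    refine (hN _ hnk _ (SimpleGraph.turanGraph n k) (fun x => ⟨x.1.1 + k * x.2.1, hlt x⟩)
      (fun x y h => ?_) fun x y h => ?_).trans (measureReal_mono fun D hD => ?_)
    · have h : x.1.1 + k * x.2.1 = y.1.1 + k * y.2.1 := Fin.mk.inj h
      have h1 : x.1.1 = y.1.1 := by rw [← hmod x, h, hmod y]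
      have h2 : k * x.2.1 = k * y.2.1 := by omega
      exact Prod.ext (Fin.ext h1) (Fin.ext (Nat.eq_of_mul_eq_mul_left hk h2))
    · simp only [SimpleGraph.turanGraph, hmod]
      exact fun h' => h (Fin.ext h')
    · -- The class of residue `k - 1` modulo `k` is a smallest one.
      have hcard : Nat.card {v : Fin n // (⟨v.1 % k, Nat.mod_lt _ hk⟩ : Fin k) =
          ⟨k - 1, by omega⟩} ≤ n / k := by
        have hv : ∀ v : {v : Fin n // (⟨v.1 % k, Nat.mod_lt _ hk⟩ : Fin k) = ⟨k - 1, by omega⟩},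
            v.1.1 / k < n / k := by
          intro v
          have h1 : v.1.1 % k = k - 1 := Fin.mk.inj v.2
          have h2 := Nat.div_add_mod v.1.1 k
          have h3 := v.1.2
          rw [← Nat.succ_le_iff, Nat.le_div_iff_mul_le hk, Nat.succ_mul, mul_comm]
          omega
        have := Nat.card_le_card_of_injective
          (fun v => (⟨v.1.1 / k, hv v⟩ : Fin (n / k))) (fun u v h => by
            have h1 : u.1.1 % k = k - 1 := Fin.mk.inj u.2
            have h2 : v.1.1 % k = k - 1 := Fin.mk.inj v.2
            have h3 : u.1.1 / k = v.1.1 / k := Fin.mk.inj h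
            refine Subtype.ext (Fin.ext ?_)
            rw [← Nat.div_add_mod u.1.1 k, ← Nat.div_add_mod v.1.1 k, h1, h2, h3])
        simpa using this
      have h := feedbackCliqueNumber_eq (G := SimpleGraph.turanGraph n k)
        (fun v : Fin n => (⟨v.1 % k, Nat.mod_lt _ hk⟩ : Fin k))
        (fun u v h h' => h (Fin.mk.inj h')) D ⟨k - 1, by omega⟩ hcard hD
      simp only [Set.mem_ofPred_eq, h]
      omega
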